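/- **(Lemma.)** Let $V$ be a finite-dimensional real vector space with basis $(v_j)_{j\in J}$, and let $$\sum_{i\in I} a_{ik}x_i+\sum_{j\in J} b_{jk}v_j=0\qquad(k\in K)$$ be a finite system of linear equations with real coefficients in unknowns $x_i\in V$ ($i \in I$), with $I$, $J$, $K$ finite. Suppose that (1) the system has exactly one solution $(x_i)_{i\in I}\in V^{I}$, and (2) for every subset $A\subseteq K$ and all $i\in I$, $j\in J$ one has $\sum_{k\in A}a_{ik}\in\{-1,0,1\}$ and $\sum_{k\in A}b_{jk}\in\{-1,0,1\}$. Then the unique solution satisfies $x_i=\sum_{j} c_{ij}v_j$ with all $c_{ij}\in\{-1,0,1\}$. **(Corollary.)** Let $\Gamma\subset\mathrm{PSL}_2(\mathbb R)$ be a Fuchsian group of the first kind, i.e. a discrete subgroup of finite covolume. Let $\mathcal F\subset\mathbb H$ be a fundamental polygon for $\Gamma$: an open, connected, hyperbolically convex set with piecewise geodesic boundary such that every compact set meets only finitely many translates $\gamma\overline{\mathcal F}$, $\gamma \in \Gamma$; every point of $\mathbb H$ is $\Gamma$-equivalent to a point of $\overline{\mathcal F}$; and any two $\Gamma$-equivalent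 points of $\overline{\mathcal F}$ are either equal or both in $\partial\mathcal F$. A side of $\mathcal F$ is a set $\gamma\overline{\mathcal F}\cap\overline{\mathcal F}$ with $1\neq\gamma\in\Gamma$ that contains more than one point, and $\mathcal S(\mathcal F)$ denotes the set of side pairing transformations: those $1\ne\sigma\in\Gamma$ for which there is a side $L$ such that $\sigma^{-1}L$ is also a side. For $\sigma\in\Gamma$ and $z\in\mathbb H$ let $\{z,\sigma z\}\in H_1(\Gamma\backslash\mathbb H,\mathbb R)$ be the singular homology class of the image in $\Gamma\backslash\mathbb H$ of the oriented geodesic (equivalently, of any path in $\mathbb H$) from $z$ to $\sigma z$. Let $B$ be a basis of $H_1(\Gamma\backslash\mathbb H,\mathbb R)$ consisting of classes of the form $\{z,\sigma z\}$ with $\sigma\in\mathcal S(\mathcal F)$ and $z\in\mathbb H$, and let $B^*\subset H^1(\Gamma\backslash\mathbb H,\mathbb R)$ be its dual basis with respect to the natural pairing $\langle\cdot,\cdot\rangle$ between $H_1$ and $H^1$. Then for every $\sigma\in\mathcal S(\mathcal F)$ and $z\in\mathbb H$ the coordinates of $\{z,\sigma z\}$ in the basis $B$ all lie in $\{-1,0,1\}$;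 in particular $|\langle\{z,\sigma z\},\omega\rangle|\le 1$ for every $\omega\in B^*$. -/

import Mathlib

open scoped MatrixGroups UpperHalfPlane Pointwise
open CategoryTheory MeasureTheory Topology

noncomputable section

/-! ### The action of `PSL(2, ℝ)` on the upper half-plane -/

/-- `PSL(2, ℝ)` acts on `ℍ` by Möbius transformations. -/
instance pslAction : MulAction PSL(2, ℝ) ℍ :=
  MulAction.compHom ℍ (Matrix.ProjectiveSpecialLinearGroup.toPGL (n := Fin 2) (R := ℝ))

/-- The class of a matrix `g` acts as the Möbius transformation of `g`. -/
theorem pslAction_mk (g : SL(2, ℝ)) (z : ℍ) : (QuotientGroup.mk g : PSL(2, ℝ)) • z = g • z := rfl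

/-- A Fuchsian group (of the first kind): a discrete subgroup of `PSL(2, ℝ)` of finite covolume,
i.e. with a measurable fundamental domain of finite hyperbolic area. -/
def IsFuchsian (Γ : Subgroup PSL(2, ℝ)) : Prop :=
  DiscreteTopology Γ ∧ ∃ D : Set ℍ, IsFundamentalDomain Γ D volume ∧ volume D < ⊤

/-! ### Fundamental polygons and side pairings -/

/-- The hyperbolic geodesic segment between `z` and `w`. -/
def geodesicSegment (z w : ℍ) : Set ℍ := {x | dist z x + dist x w = dist z w}

/-- A closed geodesic arc (a point, segment, ray or full geodesic of `ℍ`): a closed convex set,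
any three points of which lie on one geodesic. -/
def IsGeodesicArc (s : Set ℍ) : Prop :=
  IsClosed s ∧ (∀ z ∈ s, ∀ w ∈ s, geodesicSegment z w ⊆ s) ∧
    ∀ x ∈ s, ∀ y ∈ s, ∀ z ∈ s,
      x ∈ geodesicSegment y z ∨ y ∈ geodesicSegment x z ∨ z ∈ geodesicSegment x y

/-- `F` is a fundamental polygon for `Γ`: a locally finite fundamental domain (open and connected)
which is hyperbolically convex with piecewise geodesic boundary. Closures and boundaries are taken
in `ℍ`. -/
structure IsFundamentalPolygon (Γ : Subgroup PSL(2, ℝ)) (F : Set ℍ) : Prop where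
  isOpen : IsOpen F
  isConnected : IsConnected F
  locallyFinite : ∀ K : Set ℍ, IsCompact K → {γ : Γ | ((γ • closure F) ∩ K).Nonempty}.Finite
  covers : ∀ z : ℍ, ∃ γ : Γ, γ • z ∈ closure F
  boundary_of_equiv : ∀ z₁ ∈ closure F, ∀ z₂ ∈ closure F, (∃ γ : Γ, γ • z₁ = z₂) →
    z₁ = z₂ ∨ (z₁ ∈ frontier F ∧ z₂ ∈ frontier F)
  convex : ∀ z ∈ F, ∀ w ∈ F, geodesicSegment z w ⊆ F
  piecewiseGeodesic : ∃ 𝒮 : Set (Set ℍ), (∀ s ∈ 𝒮, IsGeodesicArc s) ∧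
    (∀ K : Set ℍ, IsCompact K → {s ∈ 𝒮 | (s ∩ K).Nonempty}.Finite) ∧ frontier F = ⋃₀ 𝒮

/-- A side of `F`: a set of the form `γ F̄ ∩ F̄` with `1 ≠ γ ∈ Γ` that does not degenerate to the
empty set or to a single point. -/
def IsSide (Γ : Subgroup PSL(2, ℝ)) (F L : Set ℍ) : Prop :=
  L.Nontrivial ∧ ∃ γ : Γ, γ ≠ 1 ∧ L = (γ • closure F) ∩ closure F

/-- The side pairing transformations of `F`: the non-trivial `σ ∈ Γ` such that `σ⁻¹` takes some
side `L` of `F` to a side of `F`. -/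
def sidePairings (Γ : Subgroup PSL(2, ℝ)) (F : Set ℍ) : Set Γ :=
  {σ | σ ≠ 1 ∧ ∃ L : Set ℍ, IsSide Γ F L ∧ IsSide Γ F (σ⁻¹ • L)}

/-! ### Real singular homology and cohomology in degree one -/

section Homology

variable (X : Type) [TopologicalSpace X]

/-- The singular chain complex of `X` with real coefficients. -/
abbrev realChains : ChainComplex (ModuleCat.{0} ℝ) ℕ :=
  ((AlgebraicTopology.singularChainComplexFunctor (ModuleCat.{0} ℝ)).obj
    (ModuleCat.of ℝ ℝ)).obj (TopCat.of X)

/-- Singular homology `H₁(X, ℝ)`. -/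
abbrev RealH1 : ModuleCat.{0} ℝ := (realChains X).homology 1

theorem realH1_eq : RealH1 X =
    ((AlgebraicTopology.singularHomologyFunctor (ModuleCat.{0} ℝ) 1).obj
      (ModuleCat.of ℝ ℝ)).obj (TopCat.of X) := rfl

variable {X}

/-- The singular `1`-simplex of a path, as a generator `ℝ ⟶ C₁(X, ℝ)`. -/
def pathChain {x y : X} (p : Path x y) : ModuleCat.of ℝ ℝ ⟶ (realChains X).X 1 :=
  SSet.ιChainComplex (TopCat.toSSet.obj (TopCat.of X))
    (TopCat.toSSetObjEdgeEquiv.symm (TopCat.pathEquiv.symm p)).edge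

theorem pathChain_d {x : X} (p : Path x x) : pathChain p ≫ (realChains X).d 1 0 = 0 := by
  refine (SSet.ιChainComplex_d (TopCat.toSSet.obj (TopCat.of X)) (ModuleCat.of ℝ ℝ) _).trans ?_
  simp [Fin.sum_univ_two]
  rfl

/-- The class in `H₁(X, ℝ)` of a loop. -/
def loopClass {x : X} (p : Path x x) : RealH1 X :=
  ((realChains X).liftCycles (pathChain p) 0 (by simp) (pathChain_d p) ≫
    (realChains X).homologyπ 1).hom (1 : ℝ)

variable (X)

/-- The coboundary `Cⁿ(X, ℝ) → Cⁿ⁺¹(X, ℝ)` of singular cochains. -/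
def realCoboundary (n : ℕ) :
    ((realChains X).X n ⟶ ModuleCat.of ℝ ℝ) →ₗ[ℝ] ((realChains X).X (n + 1) ⟶ ModuleCat.of ℝ ℝ) :=
  Linear.leftComp ℝ _ ((realChains X).d (n + 1) n)

/-- Singular cohomology `H¹(X, ℝ)`: cocycles modulo coboundaries. -/
abbrev RealCoh1 : Type :=
  (realCoboundary X 1).ker ⧸ (realCoboundary X 0).range.submoduleOf (realCoboundary X 1).ker

/-- The evaluation of cocycles on homology classes. -/
def cocyclePairing : (realCoboundary X 1).ker →ₗ[ℝ] (RealH1 X ⟶ ModuleCat.of ℝ ℝ) where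
  toFun φ := (realChains X).homologyι 1 ≫
    (realChains X).descOpcycles φ.1 2 (by simp) (show (realChains X).d 2 1 ≫ φ.1 = 0 from φ.2)
  map_add' φ ψ := by
    rw [← Preadditive.comp_add]
    congr 1
    simp [← cancel_epi ((realChains X).pOpcycles 1)]
  map_smul' a φ := by
    rw [RingHom.id_apply, ← Linear.comp_smul]
    congr 1
    simp [← cancel_epi ((realChains X).pOpcycles 1)]

theorem cocyclePairing_coboundary :
    (realCoboundary X 0).range.submoduleOf (realCoboundary X 1).ker ≤
      (cocyclePairing X).ker := by
  rintro ⟨φ, hφ⟩ ⟨ψ, rfl⟩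
  have h : (realChains X).descOpcycles (realCoboundary X 0 ψ) 2 (by simp) hφ =
      (realChains X).fromOpcycles 1 0 ≫ ψ := by
    simp [← cancel_epi ((realChains X).pOpcycles 1), realCoboundary]
  change (realChains X).homologyι 1 ≫
    (realChains X).descOpcycles (realCoboundary X 0 ψ) 2 (by simp) hφ = 0
  rw [h, HomologicalComplex.homologyι_comp_fromOpcycles_assoc, Limits.zero_comp]

/-- The pairing `⟨·, ·⟩ : H₁(X, ℝ) × H¹(X, ℝ) → ℝ` (linear in both variables). -/
def capPairing (v : RealH1 X) (ω : RealCoh1 X) : ℝ :=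
  (Submodule.liftQ _ (cocyclePairing X) (cocyclePairing_coboundary X) ω).hom v

variable {X}

/-- The dual basis `B* ⊆ H¹(X, ℝ)` of a basis `B` of `H₁(X, ℝ)` with respect to the pairing. -/
def dualBasis {ι : Type*} (B : Module.Basis ι ℝ (RealH1 X)) : Set (RealCoh1 X) :=
  {ω | ∃ i, capPairing X (B i) ω = 1 ∧ ∀ j, j ≠ i → capPairing X (B j) ω = 0}

end Homology

/-! ### Homology classes of elements of `Γ` -/

/-- The quotient `Γ \ ℍ` with the quotient topology. -/
abbrev QuotSpace (Γ : Subgroup PSL(2, ℝ)) : Type := MulAction.orbitRel.Quotient Γ ℍ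

/-- The loop in `Γ \ ℍ` which is the image of a path in `ℍ` from `z` to `σ z`. -/
def projLoop {Γ : Subgroup PSL(2, ℝ)} (σ : Γ) (z : ℍ) (c : Path z (σ • z)) :
    Path (Quotient.mk _ z : QuotSpace Γ) (Quotient.mk _ z) :=
  (c.map (f := (Quotient.mk _ : ℍ → QuotSpace Γ)) continuous_quotient_mk').cast rfl
    (Quotient.sound (⟨σ⁻¹, by simp⟩ : MulAction.orbitRel Γ ℍ z (σ • z)))

/-- The class `{z, σ z} ∈ H₁(Γ \ ℍ, ℝ)` of a path `c` in `ℍ` from `z` to `σ z` (for instance the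
oriented geodesic; as `ℍ` is contractible, all paths `c` give the same class). -/
def sideClass {Γ : Subgroup PSL(2, ℝ)} (σ : Γ) (z : ℍ) (c : Path z (σ • z)) :
    RealH1 (QuotSpace Γ) :=
  loopClass (projLoop σ z c)

end

/-! Lemma. Uniqueness forces the vectors `a i` in `K → ℝ` to be linearly independent, since a
relation among them could be added to the solution. Hence for fixed `i` some `w : K → ℝ` pairs to 1
with `a i` and to 0 with the other `a i'`. By the subset-sum condition each row has at most one
entry 1, at most one entry -1, and zeros elsewhere. So for every `φ` with `φ 0 = 0`, pairing a row
with `φ ∘ w` gives a difference `φ p - φ q` of two values (`exists_sum_eq_sub`). If `φ` is a unit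
step jumping at the larger of the two values belonging to row `i`, then `φ ∘ w` has the same
pairings with all rows `a i'`. Pairing the system with `φ ∘ w` exhibits the coordinate of `x i` as a
difference of two values of a unit step, hence as -1, 0 or 1.

Corollary. The same rounding is applied to relations among side pairings. The classes `{z, σ z}`
depend only on `σ` and define a homomorphism from `Γ` to homology (`exists_sideClass_hom`), through
which every homomorphism `Γ → ℝ` factors (`exists_functional_of_hom`). Thus a linear relation among
such classes is a combination of group elements killed by all homomorphisms to `ℝ`.

Going once around a point `z`, the tiles `γ F̄` form a cycle, and the quotients of successive labels
give a relation at `z`. By linear duality these vertex relations span, up to antisymmetrization, all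
killed combinations of side pairings (`exists_relation_eq`): a function on side pairings satisfying
them has a potential around each point, the potentials glue because `ℍ` is simply connected, and the
result is a homomorphism (`exists_hom`).

In a combination with weights `μ` on the points of the quotient, the coefficient of `σ` is a sum of
signed weights over the ends of the side `F̄ ∩ σ F̄`, with at most one sign +1 and at most one sign
-1 (`relation_apply`, `eq_of_incidence_eq_one`). At interior points of a side the two contributions
cancel, and a side running to infinity simply lacks an end. The coefficients therefore have the
shape required above. Replacing `μ` by a step function of `μ` yields a relation with coefficients in
{-1, 0, 1} and no new terms, from which the coordinate is read off (`repr_hom_mem`). -/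

/-! ### Rounding solutions of linear systems by step functions -/

/-- The step function with a jump at `t`, normalized to vanish at `0`. -/
noncomputable def step (t x : ℝ) : ℝ := (if t ≤ x then 1 else 0) - (if t ≤ 0 then 1 else 0)

theorem step_zero (t : ℝ) : step t 0 = 0 := by simp [step]

theorem step_sub_mem (t x y : ℝ) : step t x - step t y ∈ ({-1, 0, 1} : Set ℝ) := by
  unfold step
  split_ifs <;> norm_num

theorem step_sub_of_sub_eq_one {x y : ℝ} (h : x - y = 1) : step x x - step x y = 1 := by
  have : ¬ x ≤ y := by linarith
  simp [step, this]

/-- A signed sum with at most one coefficient `1` and at most one coefficient `-1` is a difference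
of two values. -/
theorem exists_sum_eq_sub {K : Type*} (s : Finset K) (r : K → ℝ)
    (hr : ∀ k ∈ s, r k ∈ ({-1, 0, 1} : Set ℝ))
    (hpos : ∀ k ∈ s, ∀ l ∈ s, r k = 1 → r l = 1 → k = l)
    (hneg : ∀ k ∈ s, ∀ l ∈ s, r k = -1 → r l = -1 → k = l) (w : K → ℝ) :
    ∃ x y : ℝ, ∀ φ : ℝ → ℝ, φ 0 = 0 → ∑ k ∈ s, r k * φ (w k) = φ x - φ y := by
  classical
  have aux : ∀ P : Finset K, (∀ k ∈ P, ∀ l ∈ P, k = l) →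
      ∃ x : ℝ, ∀ φ : ℝ → ℝ, φ 0 = 0 → ∑ k ∈ P, φ (w k) = φ x := by
    intro P hP
    rcases P.eq_empty_or_nonempty with rfl | ⟨k, hk⟩
    · exact ⟨0, fun φ h => by simp [h]⟩
    · have : P = {k} := by
        ext l
        simp only [Finset.mem_singleton]
        exact ⟨fun hl => hP l hl k hk, fun h => h ▸ hk⟩
      exact ⟨w k, fun φ h => by simp [this]⟩
  obtain ⟨x, hx⟩ := aux (s.filter fun k => r k = 1) (by
    simp only [Finset.mem_filter]
    exact fun k hk l hl => hpos k hk.1 l hl.1 hk.2 hl.2)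
  obtain ⟨y, hy⟩ := aux (s.filter fun k => r k = -1) (by
    simp only [Finset.mem_filter]
    exact fun k hk l hl => hneg k hk.1 l hl.1 hk.2 hl.2)
  refine ⟨x, y, fun φ h => ?_⟩
  rw [← hx φ h, ← hy φ h, Finset.sum_filter, Finset.sum_filter, ← Finset.sum_sub_distrib]
  refine Finset.sum_congr rfl fun k hk => ?_
  rcases hr k hk with h | h | h
  · norm_num [h]
  · norm_num [h]
  · have : r k = 1 := h
    norm_num [this]

theorem coeff_mem_of_unique_solution {I J K V : Type*} [AddCommGroup V] [Module ℝ V]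
    [Fintype I] [Fintype J] [Fintype K]
    (v : Module.Basis J ℝ V) (a : I → K → ℝ) (b : J → K → ℝ)
    (huniq : ∃! x : I → V, ∀ k, ∑ i, a i k • x i + ∑ j, b j k • v j = 0)
    (ha : ∀ (A : Finset K) (i : I), ∑ k ∈ A, a i k ∈ ({-1, 0, 1} : Set ℝ))
    (hb : ∀ (A : Finset K) (j : J), ∑ k ∈ A, b j k ∈ ({-1, 0, 1} : Set ℝ))
    (x : I → V) (hx : ∀ k, ∑ i, a i k • x i + ∑ j, b j k • v j = 0) (i : I) (j : J) :
    v.repr (x i) j ∈ ({-1, 0, 1} : Set ℝ) := by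
  classical
  have hinj : LinearIndependent ℝ a := by
    rw [Fintype.linearIndependent_iff]
    intro g hg i
    -- A relation `g` among the rows, placed in the direction `v j`, solves the homogeneous system.
    have h0 : x + (fun i => g i • v j) = x := huniq.unique (fun k => by
      have := congr_fun hg k
      simp only [Finset.sum_apply, Pi.smul_apply, smul_eq_mul, Pi.zero_apply] at this
      simp only [Pi.add_apply, smul_add, Finset.sum_add_distrib, smul_smul]
      rw [← Finset.sum_smul]
      simp_rw [mul_comm (a _ k)]
      rw [this, zero_smul, add_zero, hx k]) hx
    have h1 : g i • v j = 0 := by simpa using congr_fun h0 i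
    exact (smul_eq_zero.1 h1).resolve_right (v.ne_zero j)
  -- Independence gives a functional on `K → ℝ` dual to `a i`; `w` is its coefficient vector.
  obtain ⟨w, hw⟩ : ∃ w : K → ℝ, ∀ i', ∑ k, a i' k * w k = if i' = i then 1 else 0 := by
    obtain ⟨g, hg⟩ := (Fintype.linearCombination ℝ a).exists_leftInverse_of_injective
      (LinearMap.ker_eq_bot.2 (linearIndependent_iff_injective_fintypeLinearCombination.1 hinj))
    let f : (K → ℝ) →ₗ[ℝ] ℝ := LinearMap.proj i ∘ₗ g
    have hf : ∀ i', f (a i') = if i' = i then 1 else 0 := by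
      intro i'
      have := congr_fun (LinearMap.congr_fun hg (Pi.single i' 1)) i
      simpa [f, Fintype.linearCombination_apply_single, Pi.single_apply, eq_comm] using this
    refine ⟨fun k => f (Pi.single k 1), fun i' => ?_⟩
    rw [← hf, LinearMap.pi_apply_eq_sum_univ f (a i')]
    refine Finset.sum_congr rfl fun k _ => ?_
    rw [smul_eq_mul]
    refine congr_arg _ (congr_arg f (funext fun l => ?_))
    simp [Pi.single_apply, eq_comm]
  have hrow : ∀ (r : K → ℝ), (∀ A : Finset K, ∑ k ∈ A, r k ∈ ({-1, 0, 1} : Set ℝ)) →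
      ∃ x y : ℝ, ∀ φ : ℝ → ℝ, φ 0 = 0 → ∑ k, r k * φ (w k) = φ x - φ y := by
    intro r hr
    refine exists_sum_eq_sub _ r (fun k _ => by simpa using hr {k}) ?_ ?_ w
    -- Two equal nonzero entries would give a two-element subset sum of 2 or -2.
    · intro k _ l _ hk hl
      by_contra hne
      have := hr {k, l}
      rw [Finset.sum_pair hne, hk, hl] at this
      norm_num at this
    · intro k _ l _ hk hl
      by_contra hne
      have := hr {k, l}
      rw [Finset.sum_pair hne, hk, hl] at this
      norm_num at this
  choose p q hpq using fun i' => hrow (a i') (fun A => ha A i')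
  obtain ⟨p', q', hpq'⟩ := hrow (b j) (fun A => hb A j)
  have hsub : ∀ i', p i' - q i' = if i' = i then 1 else 0 := fun i' => by
    rw [← hw i']; exact (hpq i' id rfl).symm
  -- For `i' ≠ i` the two values `p i'` and `q i'` coincide, so any `φ` gives 0; for `i' = i` they
  -- differ by 1 and the step jumps exactly at the larger one.
  have hstep : ∀ i', ∑ k, a i' k * step (p i) (w k) = if i' = i then 1 else 0 := by
    intro i'
    rw [hpq i' _ (step_zero _)]
    split_ifs with h
    · subst h; exact step_sub_of_sub_eq_one (by simpa using hsub i')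
    · have := hsub i'
      rw [if_neg h, sub_eq_zero] at this
      rw [this, sub_self]
  have hcoord : ∀ k, ∑ i', a i' k * v.repr (x i') j + b j k = 0 := by
    intro k
    have := congr_arg (fun y => v.repr y j) (hx k)
    simpa [Finsupp.single_apply] using this
  -- Pairing the `j`-th coordinates of the equations with the rounded `w` isolates the unknown `x
  -- i`.
  have key : v.repr (x i) j = step (p i) q' - step (p i) p' := by
    have h1 : ∑ k, (∑ i', a i' k * v.repr (x i') j + b j k) * step (p i) (w k) = 0 := by
      simp [hcoord]
    simp_rw [add_mul, Finset.sum_add_distrib, Finset.sum_mul] at h1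
    rw [Finset.sum_comm, hpq' _ (step_zero _)] at h1
    have h2 : ∀ i', ∑ k, a i' k * v.repr (x i') j * step (p i) (w k) =
        v.repr (x i') j * if i' = i then 1 else 0 := by
      intro i'
      rw [← hstep i', Finset.mul_sum]
      exact Finset.sum_congr rfl fun k _ => by ring
    simp_rw [h2] at h1
    simp at h1
    linarith
  rw [key]
  exact step_sub_mem _ _ _

/-! ### Primitives of local difference cocycles -/

section Primitive

open Filter

/-- A type synonym of `ℝ` with the discrete topology. -/
def DiscreteReal : Type := ℝ

instance : AddCommGroup DiscreteReal := inferInstanceAs (AddCommGroup ℝ)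
instance : TopologicalSpace DiscreteReal := ⊥
instance : DiscreteTopology DiscreteReal := ⟨rfl⟩

/-- On a simply connected space, a local difference cocycle `k` has a primitive. -/
theorem exists_primitive {X : Type*} [TopologicalSpace X] [SimplyConnectedSpace X]
    [LocallyPathConnectedSpace X] (k : X → X → ℝ)
    (hk : ∀ x, ∀ᶠ y in 𝓝 x, ∀ᶠ y' in 𝓝 y, k x y' = k x y + k y y') :
    ∃ G : X → ℝ, ∀ x, ∀ᶠ y in 𝓝 x, G y - G x = k x y := by
  choose U hU hUo hxU using fun x => eventually_nhds_iff.1 (hk x)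
  have hself : ∀ x, k x x = 0 := fun x => by
    have := (hU x x (hxU x)).self_of_nhds
    linarith
  let κ : X → X → DiscreteReal := k
  -- The covering whose chart at `i` has coordinate `v - k i x` over `x`. Its transition functions
  -- are locally constant in `x` by the cocycle identity, although `k` itself need not be
  -- continuous.
  let Z : FiberBundleCore X X DiscreteReal :=
    { baseSet := U
      isOpen_baseSet := hUo
      indexAt := id
      mem_baseSet_at := hxU
      coordChange := fun i j x v => v + κ i x - κ j x
      coordChange_self := fun i x _ v => by simp
      continuousOn_coordChange := by
        intro i j
        rintro ⟨x, v⟩ ⟨⟨hi, hj⟩, -⟩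
        refine ContinuousAt.continuousWithinAt ?_
        refine (continuousAt_const (y := v + κ i x - κ j x)).congr ?_
        have h1 := hU i x hi
        have h2 := hU j x hj
        have : ∀ᶠ p : X × DiscreteReal in 𝓝 (x, v), p.2 = v :=
          (continuous_snd.tendsto (x, v)).eventually
            (show ∀ᶠ w in 𝓝 v, w = v by simp [nhds_discrete])
        filter_upwards [(continuous_fst.tendsto (x, v)).eventually h1,
          (continuous_fst.tendsto (x, v)).eventually h2, this] with p hp1 hp2 hp
        have e1 : κ i p.1 = κ i x + κ x p.1 := hp1
        have e2 : κ j p.1 = κ j x + κ x p.1 := hp2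
        rw [e1, e2, hp]
        abel
      coordChange_comp := fun i j l x _ v => by
        show v + κ i x - κ j x + κ j x - κ l x = v + κ i x - κ l x
        abel }
  have hcov : IsCoveringMap Z.proj :=
    IsFiberBundle.isCoveringMap fun x => ⟨Z.localTrivAt x, Z.mem_localTrivAt_baseSet x⟩
  obtain ⟨x₀⟩ : Nonempty X := inferInstance
  -- Simple connectedness lifts the identity map to a section; its fibre coordinate is the
  -- primitive, because in the chart at `x` it is continuous with discrete values, hence constant
  -- near `x`.
  obtain ⟨F, ⟨-, hF⟩, -⟩ := hcov.existsUnique_continuousMap_lifts (.id X) x₀ (⟨x₀, (0 : ℝ)⟩ : Z.TotalSpace) rfl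
  have hF1 : ∀ y, (F y).1 = y := fun y => congr_fun hF y
  refine ⟨fun y => show ℝ from (F y).2, fun x => ?_⟩
  have hcont : ContinuousAt (fun y => (Z.localTrivAt x (F y)).2) x := by
    have h1 : ContinuousAt (Z.localTrivAt x) (F x) :=
      (Z.localTrivAt x).continuousAt (by
        rw [Bundle.Trivialization.mem_source, hF1 x]; exact Z.mem_localTrivAt_baseSet x)
    exact continuous_snd.continuousAt.comp (h1.comp F.continuous.continuousAt)
  have hval : ∀ y, (Z.localTrivAt x (F y)).2 = (show DiscreteReal from (F y).2) + κ (F y).1 (F y).1 -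
      κ x (F y).1 := fun y => rfl
  have hev := hcont.eventually (show ∀ᶠ w in 𝓝 (Z.localTrivAt x (F x)).2,
    w = (Z.localTrivAt x (F x)).2 by simp [nhds_discrete])
  filter_upwards [hev] with y hy
  rw [hval, hval, hF1, hF1] at hy
  have e : (show ℝ from (F y).2) + k y y - k x y = (show ℝ from (F x).2) + k x x - k x x := hy
  rw [hself] at e
  linarith

end Primitive

/-! ### The projective model of the hyperbolic plane -/

/-- The projective model: `ℍ` is identified with the interior of a parabola, in such a way that
geodesics become straight segments. -/
def kleinMap (z : ℍ) : ℝ × ℝ := (z.re, z.re ^ 2 + z.im ^ 2)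

/-- The interior of the standard parabola. -/
def parabolaInterior : Set (ℝ × ℝ) := {p | p.1 ^ 2 < p.2}

theorem isOpen_parabolaInterior : IsOpen parabolaInterior :=
  isOpen_lt (by fun_prop) (by fun_prop)

theorem kleinMap_mem (z : ℍ) : kleinMap z ∈ parabolaInterior := by
  have := z.im_pos
  simp only [parabolaInterior, kleinMap, Set.mem_ofPred_eq]
  nlinarith

theorem continuous_kleinMap : Continuous kleinMap := by
  unfold kleinMap
  have h1 := UpperHalfPlane.continuous_re
  have h2 := UpperHalfPlane.continuous_im
  fun_prop

/-- The projective model as a homeomorphism. -/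
noncomputable def kleinHomeomorph : ℍ ≃ₜ parabolaInterior where
  toFun z := ⟨kleinMap z, kleinMap_mem z⟩
  invFun p := ⟨⟨p.1.1, √(p.1.2 - p.1.1 ^ 2)⟩, Real.sqrt_pos.2 (sub_pos.2 p.2)⟩
  left_inv z := by
    refine UpperHalfPlane.ext (Complex.ext ?_ ?_)
    · rfl
    · show √(z.re ^ 2 + z.im ^ 2 - z.re ^ 2) = z.im
      rw [add_sub_cancel_left, Real.sqrt_sq z.im_pos.le]
  right_inv p := by
    have h : (0 : ℝ) ≤ p.1.2 - p.1.1 ^ 2 := (sub_pos.2 p.2).le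
    apply Subtype.ext
    apply Prod.ext
    · rfl
    · show p.1.1 ^ 2 + √(p.1.2 - p.1.1 ^ 2) ^ 2 = p.1.2
      rw [Real.sq_sqrt h]; ring
  continuous_toFun := continuous_kleinMap.subtype_mk _
  continuous_invFun := by
    rw [UpperHalfPlane.isEmbedding_coe.continuous_iff]
    have : Continuous fun p : parabolaInterior =>
        Complex.equivRealProdCLM.symm (p.1.1, √(p.1.2 - p.1.1 ^ 2)) := by fun_prop
    exact this

theorem isOpenEmbedding_kleinMap : IsOpenEmbedding kleinMap :=
  isOpen_parabolaInterior.isOpenEmbedding_subtypeVal.comp kleinHomeomorph.isOpenEmbedding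

theorem exists_kleinMap_eq {p : ℝ × ℝ} (hp : p ∈ parabolaInterior) : ∃ z, kleinMap z = p :=
  ⟨kleinHomeomorph.symm ⟨p, hp⟩, congr_arg Subtype.val (kleinHomeomorph.apply_symm_apply ⟨p, hp⟩)⟩

theorem convex_parabolaInterior : Convex ℝ parabolaInterior := by
  rintro ⟨x, s⟩ h ⟨x', s'⟩ h' a b ha hb hab
  simp only [parabolaInterior, Set.mem_ofPred_eq, Prod.smul_mk, Prod.mk_add_mk, smul_eq_mul] at *
  obtain rfl : b = 1 - a := by linarith
  have h1 : (a * x + (1 - a) * x') ^ 2 ≤ a * x ^ 2 + (1 - a) * x' ^ 2 := by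
    nlinarith [mul_nonneg (mul_nonneg ha hb) (sq_nonneg (x - x'))]
  rcases eq_or_lt_of_le ha with rfl | ha
  · nlinarith
  · nlinarith [mul_pos ha (sub_pos.2 h), mul_nonneg hb (sub_pos.2 h').le]

/-- On the hyperboloid the point `u` is a combination `a z + b w`, where `a` and `b` are the affine
weights rescaled by imaginary parts, and `cosh dist` is the bilinear form. So `cosh` and `sinh` of
both partial distances are explicit, and the addition formula gives the length of `z w`. -/
theorem mem_geodesicSegment_of_kleinMap {z w u : ℍ}
    (h : kleinMap u ∈ segment ℝ (kleinMap z) (kleinMap w)) : u ∈ geodesicSegment z w := by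
  obtain ⟨p, q, hp, hq, hpq, h⟩ := h
  have hz := z.im_pos
  have hw := w.im_pos
  have hu := u.im_pos
  have h1 : p * z.re + q * w.re = u.re := congr_arg Prod.fst h
  have h2 : p * (z.re ^ 2 + z.im ^ 2) + q * (w.re ^ 2 + w.im ^ 2) = u.re ^ 2 + u.im ^ 2 :=
    congr_arg Prod.snd h
  set c := Real.cosh (dist z w) with hc
  have hcv : c * (2 * z.im * w.im) = (z.re - w.re) ^ 2 + z.im ^ 2 + w.im ^ 2 := by
    rw [hc, UpperHalfPlane.cosh_dist']
    field_simp
  set a := p * z.im / u.im with ha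
  set b := q * w.im / u.im with hb
  have ha0 : 0 ≤ a := by positivity
  have hb0 : 0 ≤ b := by positivity
  have hau : a * u.im = p * z.im := by rw [ha]; field_simp
  have hbu : b * u.im = q * w.im := by rw [hb]; field_simp
  obtain rfl : p = 1 - q := by linarith
  -- This is the normalization of `u` on the hyperboloid.
  have e0 : (a ^ 2 + b ^ 2 + 2 * a * b * c) * u.im ^ 2 = 1 * u.im ^ 2 := by
    have : (a ^ 2 + b ^ 2 + 2 * a * b * c) * u.im ^ 2 =
        (a * u.im) ^ 2 + (b * u.im) ^ 2 + 2 * (a * u.im) * (b * u.im) * c := by ring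
    rw [this, hau, hbu]
    have e1 : u.im ^ 2 = (1 - q) * (z.re ^ 2 + z.im ^ 2) + q * (w.re ^ 2 + w.im ^ 2) -
      ((1 - q) * z.re + q * w.re) ^ 2 := by rw [h1, h2]; ring
    rw [e1]
    linear_combination (1 - q) * q * hcv
  have e : a ^ 2 + b ^ 2 + 2 * a * b * c = 1 := mul_right_cancel₀ (by positivity) e0
  have c1 : Real.cosh (dist z u) = a + b * c := by
    rw [UpperHalfPlane.cosh_dist', div_eq_iff (by positivity)]
    have : (a + b * c) * (2 * z.im * u.im) =
      2 * z.im * (a * u.im) + (b * u.im) * c * (2 * z.im) := by ring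
    rw [this, hau, hbu]
    linear_combination (-q) * hcv - h2 + (2 * z.re) * h1
  have c2 : Real.cosh (dist u w) = a * c + b := by
    rw [UpperHalfPlane.cosh_dist', div_eq_iff (by positivity)]
    have : (a * c + b) * (2 * u.im * w.im) =
      2 * w.im * (b * u.im) + (a * u.im) * c * (2 * w.im) := by ring
    rw [this, hau, hbu]
    linear_combination (-(1 - q)) * hcv - h2 + (2 * w.re) * h1
  have hsq : Real.sinh (dist z w) ^ 2 = c ^ 2 - 1 := Real.sinh_sq _
  have hs0 : 0 ≤ Real.sinh (dist z w) := Real.sinh_nonneg_iff.2 dist_nonneg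
  have s1 : Real.sinh (dist z u) = b * Real.sinh (dist z w) := by
    rw [← sq_eq_sq₀ (Real.sinh_nonneg_iff.2 dist_nonneg) (by positivity), mul_pow, hsq,
      Real.sinh_sq, c1]
    linear_combination e
  have s2 : Real.sinh (dist u w) = a * Real.sinh (dist z w) := by
    rw [← sq_eq_sq₀ (Real.sinh_nonneg_iff.2 dist_nonneg) (by positivity), mul_pow, hsq,
      Real.sinh_sq, c2]
    linear_combination e
  have key : Real.cosh (dist z u + dist u w) = c := by
    rw [Real.cosh_add, c1, c2, s1, s2]
    linear_combination c * e + a * b * hsq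
  show dist z u + dist u w = dist z w
  exact Real.cosh_injOn (by simp; positivity) (by simp) (key.trans hc)

/-- Twice the signed area of a triangle in `ℝ²`. -/
def cross (a b c : ℝ × ℝ) : ℝ := (b.1 - a.1) * (c.2 - a.2) - (b.2 - a.2) * (c.1 - a.1)

theorem cross_swap (a b c : ℝ × ℝ) : cross b a c = -cross a b c := by unfold cross; ring

/-- The orientation of a hyperbolic triangle. -/
def orientation (z w u : ℍ) : ℝ := cross (kleinMap z) (kleinMap w) (kleinMap u)

theorem orientation_swap (z w u : ℍ) : orientation w z u = -orientation z w u := cross_swap _ _ _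

theorem continuous_orientation (z w : ℍ) : Continuous (orientation z w) := by
  have := continuous_kleinMap
  unfold orientation cross
  fun_prop

/-! ### Isometries -/

theorem psl_dist (γ : PSL(2, ℝ)) (z w : ℍ) : dist (γ • z) (γ • w) = dist z w := by
  induction γ using QuotientGroup.induction_on with
  | H g => exact dist_smul g z w

instance : IsIsometricSMul PSL(2, ℝ) ℍ :=
  ⟨fun γ => Isometry.of_dist_eq (psl_dist γ)⟩

theorem sl_smul_mul_denom (g : SL(2, ℝ)) (v : ℍ) :
    (g • v).re * (g 1 0 * v.re + g 1 1) - (g • v).im * (g 1 0 * v.im) = g 0 0 * v.re + g 0 1 ∧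
    (g • v).re * (g 1 0 * v.im) + (g • v).im * (g 1 0 * v.re + g 1 1) = g 0 0 * v.im := by
  have h0 : (g 1 0 * v + g 1 1 : ℂ) ≠ 0 := UpperHalfPlane.denom_ne_zero (g : GL (Fin 2) ℝ) v
  have h : ((g • v : ℍ) : ℂ) * (g 1 0 * v + g 1 1) = g 0 0 * v + g 0 1 := by
    rw [UpperHalfPlane.coe_specialLinearGroup_apply]
    exact div_mul_cancel₀ _ h0
  exact ⟨by simpa using congr_arg Complex.re h, by simpa using congr_arg Complex.im h⟩

theorem sl_det (g : SL(2, ℝ)) : g 0 0 * g 1 1 - g 0 1 * g 1 0 = 1 := by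
  rw [← Matrix.det_fin_two]; exact g.2

/-- The orientation is the determinant of the homogeneous coordinates `(1, re, |z|²)`. A matrix `g`
acts on these through its symmetric square, of determinant `(det g)³ = 1`, up to the positive
factors `|c z + d|²`. -/
theorem psl_orientation (γ : PSL(2, ℝ)) (z w u : ℍ) :
    ∃ r : ℝ, 0 < r ∧ orientation (γ • z) (γ • w) (γ • u) = r * orientation z w u := by
  induction γ using QuotientGroup.induction_on with
  | H g =>
    simp only [pslAction_mk]
    have key : ∀ v : ℍ, ∃ n : ℝ, 0 < n ∧
        n * (g • v).re = g 0 0 * g 1 0 * (v.re ^ 2 + v.im ^ 2) + (g 0 0 * g 1 1 + g 0 1 * g 1 0) * v.re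
          + g 0 1 * g 1 1 ∧
        n * ((g • v).re ^ 2 + (g • v).im ^ 2) = g 0 0 ^ 2 * (v.re ^ 2 + v.im ^ 2)
          + 2 * g 0 0 * g 0 1 * v.re + g 0 1 ^ 2 ∧
        n = g 1 0 ^ 2 * (v.re ^ 2 + v.im ^ 2) + 2 * g 1 0 * g 1 1 * v.re + g 1 1 ^ 2 := by
      intro v
      obtain ⟨h1, h2⟩ := sl_smul_mul_denom g v
      have hv := v.im_pos
      refine ⟨_, ?_, ?_, ?_, rfl⟩
      · have hdet := sl_det g
        have : g 1 0 ^ 2 * (v.re ^ 2 + v.im ^ 2) + 2 * g 1 0 * g 1 1 * v.re + g 1 1 ^ 2 =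
          (g 1 0 * v.re + g 1 1) ^ 2 + (g 1 0 * v.im) ^ 2 := by ring
        rw [this]
        by_cases hc : g 1 0 = 0
        · have : g 1 1 ≠ 0 := by
            rintro h0
            rw [hc, h0] at hdet
            simp at hdet
          rw [hc]
          simp only [zero_mul, zero_add]
          positivity
        · positivity
      · linear_combination (g 1 0 * v.re + g 1 1) * h1 + (g 1 0 * v.im) * h2
      · linear_combination ((g • v).re * (g 1 0 * v.re + g 1 1) - (g • v).im * (g 1 0 * v.im) +
          (g 0 0 * v.re + g 0 1)) * h1 + ((g • v).re * (g 1 0 * v.im) +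
          (g • v).im * (g 1 0 * v.re + g 1 1) + g 0 0 * v.im) * h2
    obtain ⟨n₁, p₁, a₁, b₁, c₁⟩ := key z
    obtain ⟨n₂, p₂, a₂, b₂, c₂⟩ := key w
    obtain ⟨n₃, p₃, a₃, b₃, c₃⟩ := key u
    have hdet := sl_det g
    refine ⟨1 / (n₁ * n₂ * n₃), by positivity, ?_⟩
    rw [one_div, eq_inv_mul_iff_mul_eq₀ (by positivity)]
    have : n₁ * n₂ * n₃ * orientation (g • z) (g • w) (g • u) =
      n₁ * ((n₂ * (g • w).re) * (n₃ * ((g • u).re ^ 2 + (g • u).im ^ 2))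
        - (n₂ * ((g • w).re ^ 2 + (g • w).im ^ 2)) * (n₃ * (g • u).re))
      - n₂ * ((n₁ * (g • z).re) * (n₃ * ((g • u).re ^ 2 + (g • u).im ^ 2))
        - (n₁ * ((g • z).re ^ 2 + (g • z).im ^ 2)) * (n₃ * (g • u).re))
      + n₃ * ((n₁ * (g • z).re) * (n₂ * ((g • w).re ^ 2 + (g • w).im ^ 2))
        - (n₁ * ((g • z).re ^ 2 + (g • z).im ^ 2)) * (n₂ * (g • w).re)) := by
      simp only [orientation, cross, kleinMap]
      ring
    rw [this, a₁, b₁, a₂, b₂, a₃, b₃, c₁, c₂, c₃]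
    have e : orientation z w u = (g 0 0 * g 1 1 - g 0 1 * g 1 0) ^ 3 * orientation z w u := by
      rw [hdet]; ring
    rw [e]
    simp only [orientation, cross, kleinMap]
    ring

theorem exists_orientation_ne_zero {U : Set ℍ} (hU : IsOpen U) (hne : U.Nonempty) {z w : ℍ}
    (hzw : z ≠ w) : ∃ u ∈ U, orientation z w u ≠ 0 := by
  by_contra! hcon
  obtain ⟨p, hp⟩ := hne
  set a := kleinMap z
  set b := kleinMap w
  have hab : a ≠ b := fun h => hzw (isOpenEmbedding_kleinMap.injective h)
  have hcont : Continuous fun t : ℝ => kleinMap p + t • ((-(b.2 - a.2), b.1 - a.1) : ℝ × ℝ) := by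
    fun_prop
  have hev : ∀ᶠ t : ℝ in 𝓝 0, kleinMap p + t • ((-(b.2 - a.2), b.1 - a.1) : ℝ × ℝ) ∈
      kleinMap '' U :=
    hcont.continuousAt.eventually ((isOpenEmbedding_kleinMap.isOpenMap U hU).mem_nhds
      (by simpa using Set.mem_image_of_mem kleinMap hp))
  obtain ⟨t, ⟨u, hu, hut⟩, ht⟩ := ((hev.filter_mono nhdsWithin_le_nhds).and
    (self_mem_nhdsWithin (s := {0}ᶜ))).exists
  have h1 : orientation z w u = orientation z w p + t * ((b.1 - a.1) ^ 2 + (b.2 - a.2) ^ 2) := by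
    simp only [orientation, cross, hut]
    simp
    ring
  rw [hcon u hu, hcon p hp, zero_add, eq_comm, mul_eq_zero] at h1
  have h2 := h1.resolve_left ht
  apply hab
  apply Prod.ext <;> nlinarith [sq_nonneg (b.1 - a.1), sq_nonneg (b.2 - a.2)]

/-- The imaginary part of the fixed-point equation is affine in `re`; two fixed points with
different real parts force the lower left entry to vanish. -/
theorem psl_eq_one_of_fixes_open (γ : PSL(2, ℝ)) {U : Set ℍ} (hU : IsOpen U) (hne : U.Nonempty)
    (h : ∀ z ∈ U, γ • z = z) : γ = 1 := by
  induction γ using QuotientGroup.induction_on with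
  | H g =>
    obtain ⟨z, hz⟩ := hne
    -- The line through `z` and `w` is vertical, so a point of `U` off this line has a real part
    -- different from that of `z`.
    let w : ℍ := ⟨⟨z.re, z.im + 1⟩, by have := z.im_pos; show 0 < z.im + 1; linarith⟩
    have hw : w.re = z.re := rfl
    have hw' : w.im = z.im + 1 := rfl
    have hzw : z ≠ w := fun h => by
      have := congr_arg UpperHalfPlane.im h
      rw [hw'] at this; linarith
    obtain ⟨u, hu, hne⟩ := exists_orientation_ne_zero hU ⟨z, hz⟩ hzw
    have hre : u.re - z.re ≠ 0 := fun h0 => hne (by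
      simp [orientation, cross, kleinMap, hw, h0])
    have hfix : ∀ v ∈ U, 2 * g 1 0 * v.re + g 1 1 = g 0 0 ∧
        v.re * (g 1 0 * v.re + g 1 1) - v.im * (g 1 0 * v.im) = g 0 0 * v.re + g 0 1 := by
      intro v hv
      obtain ⟨h1, h2⟩ := sl_smul_mul_denom g v
      have : g • v = v := h v hv
      rw [this] at h1 h2
      refine ⟨mul_right_cancel₀ v.im_pos.ne' ?_, h1⟩
      linear_combination h2
    obtain ⟨a1, a2⟩ := hfix z hz
    obtain ⟨b1, -⟩ := hfix u hu
    have hc : g 1 0 = 0 := by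
      have : (2 * g 1 0) * (u.re - z.re) = 0 := by linear_combination b1 - a1
      have := (mul_eq_zero.1 this).resolve_right hre
      linarith
    rw [hc] at a1 a2
    have hd : g 1 1 = g 0 0 := by linarith
    have hb : g 0 1 = 0 := by rw [hd] at a2; linarith
    have hdet := sl_det g
    rw [hc, hb, hd] at hdet
    rw [QuotientGroup.eq_one_iff, Matrix.SpecialLinearGroup.mem_center_iff]
    refine ⟨g 0 0, ?_, ?_⟩
    · simp only [Fintype.card_fin]; linarith
    · ext i j
      fin_cases i <;> fin_cases j <;> simp [hc, hb, hd]

/-! ### Convexity and separation in the projective model -/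

theorem eq_preimage_closure_image (A : Set ℍ) : closure A = kleinMap ⁻¹' closure (kleinMap '' A) :=
  isOpenEmbedding_kleinMap.isInducing.closure_eq_preimage_closure_image A

theorem convex_kleinMap_image {A : Set ℍ} (hA : ∀ z ∈ A, ∀ w ∈ A, geodesicSegment z w ⊆ A) :
    Convex ℝ (kleinMap '' A) := by
  rw [convex_iff_segment_subset]
  rintro _ ⟨z, hz, rfl⟩ _ ⟨w, hw, rfl⟩ p hp
  obtain ⟨u, rfl⟩ := exists_kleinMap_eq
    (convex_parabolaInterior.segment_subset (kleinMap_mem z) (kleinMap_mem w) hp)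
  exact ⟨u, hA z hz w hw (mem_geodesicSegment_of_kleinMap hp), rfl⟩

theorem mem_closure_of_mem_segment {A : Set ℍ} (hA : Convex ℝ (kleinMap '' A)) {x y u : ℍ}
    (hx : x ∈ closure A) (hy : y ∈ closure A)
    (hu : kleinMap u ∈ segment ℝ (kleinMap x) (kleinMap y)) : u ∈ closure A := by
  rw [eq_preimage_closure_image, Set.mem_preimage] at *
  exact hA.closure.segment_subset hx hy hu

/-- Two disjoint open convex sets lie on different sides of any common boundary segment. -/
theorem orientation_mul_neg {A B : Set ℍ} (hAo : IsOpen A) (hBo : IsOpen B)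
    (hA : Convex ℝ (kleinMap '' A)) (hB : Convex ℝ (kleinMap '' B)) (hAB : Disjoint A B)
    {x y p q : ℍ} (hxy : x ≠ y) (hxA : x ∈ closure A) (hyA : y ∈ closure A)
    (hxB : x ∈ closure B) (hyB : y ∈ closure B) (hp : p ∈ A) (hq : q ∈ B) :
    orientation x y p * orientation x y q < 0 := by
  -- The separating functional equals `c` at `x` and at `y`, which are adherent to both sets, so the
  -- separating line is the line through `x` and `y`.
  obtain ⟨f, c, hfA, hfB⟩ := geometric_hahn_banach_open_open hA
    (isOpenEmbedding_kleinMap.isOpenMap A hAo) hB (isOpenEmbedding_kleinMap.isOpenMap B hBo)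
    ((Set.disjoint_image_iff isOpenEmbedding_kleinMap.injective).2 hAB)
  have hle : ∀ u ∈ closure A, f (kleinMap u) ≤ c := fun u hu =>
    closure_minimal (fun v hv => (hfA _ (Set.mem_image_of_mem _ hv)).le)
      (isClosed_le (f.continuous.comp continuous_kleinMap) continuous_const) hu
  have hge : ∀ u ∈ closure B, c ≤ f (kleinMap u) := fun u hu =>
    closure_minimal (fun v hv => (hfB _ (Set.mem_image_of_mem _ hv)).le)
      (isClosed_le continuous_const (f.continuous.comp continuous_kleinMap)) hu
  have hx := le_antisymm (hle x hxA) (hge x hxB)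
  have hy := le_antisymm (hle y hyA) (hge y hyB)
  have hp := hfA _ (Set.mem_image_of_mem _ hp)
  have hq := hfB _ (Set.mem_image_of_mem _ hq)
  have hf : ∀ v : ℝ × ℝ, f v = f (1, 0) * v.1 + f (0, 1) * v.2 := by
    intro v
    have : v = v.1 • ((1, 0) : ℝ × ℝ) + v.2 • ((0, 1) : ℝ × ℝ) := by ext <;> simp
    conv_lhs => rw [this]
    rw [map_add, map_smul, map_smul]
    simp only [smul_eq_mul]
    ring
  have hne : kleinMap x ≠ kleinMap y := fun h => hxy (isOpenEmbedding_kleinMap.injective h)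
  rw [hf] at hx hy hp hq
  have hd : 0 < ((kleinMap y).1 - (kleinMap x).1) ^ 2 + ((kleinMap y).2 - (kleinMap x).2) ^ 2 := by
    by_contra! hcon
    apply hne
    apply Prod.ext <;> nlinarith [sq_nonneg ((kleinMap y).1 - (kleinMap x).1),
      sq_nonneg ((kleinMap y).2 - (kleinMap x).2)]
  set m := f (0, 1) * ((kleinMap y).1 - (kleinMap x).1) -
    f (1, 0) * ((kleinMap y).2 - (kleinMap x).2) with hm
  have key : ∀ u : ℍ, orientation x y u * m = (f (1, 0) * (kleinMap u).1 + f (0, 1) * (kleinMap u).2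
      - c) * (((kleinMap y).1 - (kleinMap x).1) ^ 2 + ((kleinMap y).2 - (kleinMap x).2) ^ 2) := by
    intro u
    simp only [orientation, cross, hm]
    linear_combination (((kleinMap u).1 - (kleinMap x).1) * ((kleinMap y).1 - (kleinMap x).1) +
      ((kleinMap u).2 - (kleinMap x).2) * ((kleinMap y).2 - (kleinMap x).2)) * (hx - hy) -
      (((kleinMap y).1 - (kleinMap x).1) ^ 2 + ((kleinMap y).2 - (kleinMap x).2) ^ 2) * hx
  have k1 : orientation x y p * m < 0 := by
    rw [key]; exact mul_neg_of_neg_of_pos (by linarith) hd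
  have k2 : 0 < orientation x y q * m := by
    rw [key]; exact mul_pos (by linarith) hd
  by_contra! hcon
  nlinarith [mul_neg_of_neg_of_pos k1 k2, mul_nonneg hcon (sq_nonneg m)]

/-- If two closed sets cover a neighbourhood of `z`, and `z` is adherent to the interiors of both,
then they have a common point which is not on a given ray from `z`. -/
theorem exists_mem_inter_not_mem_ray {z r : ℍ} (hzr : z ≠ r) {N A B A' B' : Set ℍ} (hN : N ∈ 𝓝 z)
    (hA : IsClosed A) (hB : IsClosed B) (hcov : N ⊆ A ∪ B) (hA' : IsOpen A') (hB' : IsOpen B')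
    (hAA' : A' ⊆ A) (hBB' : B' ⊆ B) (hzA : z ∈ closure A') (hzB : z ∈ closure B') :
    ∃ y ∈ A ∩ B, ∀ t : ℝ, 0 ≤ t → kleinMap y - kleinMap z ≠ t • (kleinMap r - kleinMap z) := by
  have hne : kleinMap r - kleinMap z ≠ 0 := fun h =>
    hzr (isOpenEmbedding_kleinMap.injective (sub_eq_zero.1 h).symm)
  obtain ⟨ε, hε, hball⟩ := Metric.mem_nhds_iff.1 (isOpenEmbedding_kleinMap.image_mem_nhds.2 hN)
  set S : Set (ℝ × ℝ) := {p ∈ Metric.ball (kleinMap z) ε |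
    ∀ t : ℝ, 0 ≤ t → p - kleinMap z ≠ t • (kleinMap r - kleinMap z)} with hS
  have hcont : ContinuousAt (fun s : ℝ => kleinMap z - s • (kleinMap r - kleinMap z)) 0 := by
    fun_prop
  obtain ⟨s, hs, hs0⟩ := (((hcont.eventually ((Metric.isOpen_ball (x := kleinMap z)
    (ε := ε)).mem_nhds (by simpa using hε))).filter_mono nhdsWithin_le_nhds).and
    (self_mem_nhdsWithin (s := Set.Ioi 0))).exists
  have hs0 : 0 < s := hs0
  -- A disc around `z` without the ray is star-shaped about a point on the opposite ray, hence
  -- connected. Two closed sets that cover it and both meet it must intersect in it.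
  have hstar : StarConvex ℝ (kleinMap z - s • (kleinMap r - kleinMap z)) S := by
    intro p hp a b ha hb hab
    refine ⟨(convex_ball _ _) hs hp.1 ha hb hab, fun t ht h => ?_⟩
    obtain rfl : a = 1 - b := by linarith
    have h1 : b • (p - kleinMap z) = (t + (1 - b) * s) • (kleinMap r - kleinMap z) := by
      rw [add_smul, ← h]; module
    rcases eq_or_lt_of_le hb with rfl | hb
    · rw [zero_smul, eq_comm, smul_eq_zero] at h1
      have := h1.resolve_right hne
      linarith
    · refine hp.2 ((t + (1 - b) * s) / b) (by positivity) ?_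
      rw [div_eq_inv_mul, mul_smul, ← h1, smul_smul, inv_mul_cancel₀ hb.ne', one_smul]
  have hSne : kleinMap z - s • (kleinMap r - kleinMap z) ∈ S := ⟨hs, fun t ht h => by
    have : (t + s) • (kleinMap r - kleinMap z) = 0 := by rw [add_smul, ← h]; module
    have := (smul_eq_zero.1 this).resolve_right hne
    linarith⟩
  have hconn : IsPreconnected (kleinMap ⁻¹' S) := by
    refine (hstar.isPathConnected hSne).isConnected.isPreconnected.preimage_of_isOpenMap
      isOpenEmbedding_kleinMap.injective isOpenEmbedding_kleinMap.isOpenMap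
      (fun p hp => ?_)
    obtain ⟨u, -, hu⟩ := hball hp.1
    exact ⟨u, hu⟩
  have hmeet : ∀ C : Set ℍ, IsOpen C → z ∈ closure C → (kleinMap ⁻¹' S ∩ C).Nonempty := by
    intro C hC hzC
    have ho : IsOpen (kleinMap ⁻¹' Metric.ball (kleinMap z) ε) :=
      Metric.isOpen_ball.preimage continuous_kleinMap
    obtain ⟨u, ⟨hu1, hu2⟩, hu⟩ := exists_orientation_ne_zero (ho.inter hC)
      (mem_closure_iff.1 hzC _ ho (Metric.mem_ball_self hε)) hzr
    refine ⟨u, ⟨hu1, fun t _ h => hu ?_⟩, hu2⟩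
    have e1 : (kleinMap u).1 - (kleinMap z).1 = t * ((kleinMap r).1 - (kleinMap z).1) :=
      congr_arg Prod.fst h
    have e2 : (kleinMap u).2 - (kleinMap z).2 = t * ((kleinMap r).2 - (kleinMap z).2) :=
      congr_arg Prod.snd h
    rw [orientation, cross, e1, e2]; ring
  obtain ⟨y, hy, hyAB⟩ := isPreconnected_closed_iff.1 hconn A B hA hB
    (fun y hy => by
      obtain ⟨u, hu, huy⟩ := hball hy.1
      exact hcov (isOpenEmbedding_kleinMap.injective huy ▸ hu))
    ((hmeet A' hA' hzA).mono (Set.inter_subset_inter_right _ hAA'))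
    ((hmeet B' hB' hzB).mono (Set.inter_subset_inter_right _ hBB'))
  exact ⟨y, hyAB, hy.2⟩

/-! ### The tessellation by translates of a fundamental polygon -/

section Tessellation

variable {Γ : Subgroup PSL(2, ℝ)} {F : Set ℍ}

instance : IsIsometricSMul Γ ℍ := ⟨fun γ => isometry_smul ℍ (γ : PSL(2, ℝ))⟩

theorem orientation_smul (γ : Γ) (z w u : ℍ) :
    ∃ r : ℝ, 0 < r ∧ orientation (γ • z) (γ • w) (γ • u) = r * orientation z w u :=
  psl_orientation γ z w u

theorem orientation_smul_neg_iff (γ : Γ) (z w u : ℍ) :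
    orientation (γ • z) (γ • w) (γ • u) < 0 ↔ orientation z w u < 0 := by
  obtain ⟨r, hr, h⟩ := orientation_smul γ z w u
  rw [h, mul_neg_iff]
  constructor
  · rintro (⟨-, h⟩ | ⟨h, -⟩)
    · exact h
    · linarith
  · exact fun h => Or.inl ⟨hr, h⟩

/-- The closed tile `γ F̄`. -/
def tile (F : Set ℍ) (γ : Γ) : Set ℍ := γ • closure F

theorem mem_tile {γ : Γ} {z : ℍ} : z ∈ tile F γ ↔ γ⁻¹ • z ∈ closure F :=
  Set.mem_smul_set_iff_inv_smul_mem

theorem smul_mem_tile {δ γ : Γ} {z : ℍ} : δ • z ∈ tile F (δ * γ) ↔ z ∈ tile F γ := by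
  rw [mem_tile, mem_tile, mul_inv_rev, mul_smul, inv_smul_smul]

theorem tile_eq_closure (γ : Γ) : tile F γ = closure (γ • F) := (closure_smul γ F).symm

theorem isClosed_tile (γ : Γ) : IsClosed (tile F γ) := by
  rw [tile_eq_closure]; exact isClosed_closure

theorem smul_subset_tile (γ : Γ) : γ • F ⊆ tile F γ := by
  rw [tile_eq_closure]; exact subset_closure

/-- `γ` and `γ'` label different tiles with a common side. -/
def Adjacent (F : Set ℍ) (γ γ' : Γ) : Prop := γ ≠ γ' ∧ (tile F γ ∩ tile F γ').Nontrivial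

/-- The tile `γ'` follows the tile `γ` in the clockwise or counterclockwise cyclic order around `z`:
they have a common side through `z`, which leaves `z` with the point `γ p` on its right. -/
def Follows (F : Set ℍ) (p z : ℍ) (γ γ' : Γ) : Prop :=
  γ ≠ γ' ∧ z ∈ tile F γ ∧ z ∈ tile F γ' ∧
    ∃ y, y ∈ tile F γ ∧ y ∈ tile F γ' ∧ orientation z y (γ • p) < 0

theorem follows_smul (δ : Γ) {p z : ℍ} {γ γ' : Γ} :
    Follows F p (δ • z) (δ * γ) (δ * γ') ↔ Follows F p z γ γ' := by
  unfold Follows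
  rw [smul_mem_tile, smul_mem_tile, Ne, mul_right_inj]
  refine and_congr_right fun _ => and_congr_right fun _ => and_congr_right fun _ => ?_
  constructor
  · rintro ⟨y, h1, h2, h3⟩
    refine ⟨δ⁻¹ • y, ?_, ?_, ?_⟩
    · rwa [← smul_mem_tile (δ := δ), smul_inv_smul]
    · rwa [← smul_mem_tile (δ := δ), smul_inv_smul]
    · rwa [← orientation_smul_neg_iff δ, smul_inv_smul, ← mul_smul]
  · rintro ⟨y, h1, h2, h3⟩
    exact ⟨δ • y, smul_mem_tile.2 h1, smul_mem_tile.2 h2, by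
      rwa [mul_smul, orientation_smul_neg_iff]⟩

namespace IsFundamentalPolygon

variable (h : IsFundamentalPolygon Γ F)
include h

/-- On the open set `F ∩ γ⁻¹ F` equivalent points cannot lie on the frontier, so `γ` fixes all of
it. -/
theorem eq_one_of_mem {γ : Γ} {z : ℍ} (hz : z ∈ F) (hγ : γ • z ∈ F) : γ = 1 := by
  apply Subtype.ext
  refine psl_eq_one_of_fixes_open (γ : PSL(2, ℝ)) (U := F ∩ γ⁻¹ • F)
    (h.isOpen.inter (h.isOpen.smul γ⁻¹)) ⟨z, hz, by simpa [Set.mem_inv_smul_set_iff] using hγ⟩ ?_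
  rintro w ⟨hw, hw'⟩
  rw [Set.mem_inv_smul_set_iff] at hw'
  rcases h.boundary_of_equiv w (subset_closure hw) (γ • w) (subset_closure hw') ⟨γ, rfl⟩ with e | e
  · exact e.symm
  · have := e.1.2
    rw [h.isOpen.interior_eq] at this
    exact absurd hw this

theorem disjoint_smul {γ γ' : Γ} (hne : γ ≠ γ') : Disjoint (γ • F) (γ' • F) := by
  rw [Set.disjoint_left]
  intro z hz hz'
  rw [Set.mem_smul_set_iff_inv_smul_mem] at hz hz'
  have := h.eq_one_of_mem (γ := γ'⁻¹ * γ) hz (by rwa [mul_smul, smul_inv_smul])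
  exact hne (inv_mul_eq_one.1 this).symm

theorem convex_smul (γ : Γ) : Convex ℝ (kleinMap '' (γ • F)) := by
  apply convex_kleinMap_image
  rintro _ ⟨a, ha, rfl⟩ _ ⟨b, hb, rfl⟩ u hu
  rw [Set.mem_smul_set_iff_inv_smul_mem]
  apply h.convex a ha b hb
  have hu : dist (γ • a) u + dist u (γ • b) = dist (γ • a) (γ • b) := hu
  show dist a (γ⁻¹ • u) + dist (γ⁻¹ • u) b = dist a b
  rw [← dist_smul γ a, ← dist_smul γ _ b, smul_inv_smul, hu, dist_smul]

theorem isOpen_smul (γ : Γ) : IsOpen (γ • F) := h.isOpen.smul γ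

theorem mem_tile_of_mem_segment {γ : Γ} {x y u : ℍ} (hx : x ∈ tile F γ) (hy : y ∈ tile F γ)
    (hu : kleinMap u ∈ segment ℝ (kleinMap x) (kleinMap y)) : u ∈ tile F γ := by
  rw [tile_eq_closure] at *
  exact mem_closure_of_mem_segment (h.convex_smul γ) hx hy hu

theorem orientation_mul_neg {γ γ' : Γ} (hne : γ ≠ γ') {x y p q : ℍ} (hxy : x ≠ y)
    (hx : x ∈ tile F γ) (hy : y ∈ tile F γ) (hx' : x ∈ tile F γ') (hy' : y ∈ tile F γ')
    (hp : p ∈ γ • F) (hq : q ∈ γ' • F) : orientation x y p * orientation x y q < 0 := by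
  rw [tile_eq_closure] at *
  exact _root_.orientation_mul_neg (h.isOpen_smul γ) (h.isOpen_smul γ') (h.convex_smul γ)
    (h.convex_smul γ') (h.disjoint_smul hne) hxy hx hy hx' hy' hp hq

/-- Three different tiles have at most one common point. -/
theorem subsingleton_of_three {γ₁ γ₂ γ₃ : Γ} (h₁₂ : γ₁ ≠ γ₂) (h₁₃ : γ₁ ≠ γ₃) (h₂₃ : γ₂ ≠ γ₃)
    {x y : ℍ} (hx₁ : x ∈ tile F γ₁) (hx₂ : x ∈ tile F γ₂) (hx₃ : x ∈ tile F γ₃)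
    (hy₁ : y ∈ tile F γ₁) (hy₂ : y ∈ tile F γ₂) (hy₃ : y ∈ tile F γ₃) : x = y := by
  by_contra hxy
  obtain ⟨p, hp⟩ := h.isConnected.nonempty
  have e₁₂ := h.orientation_mul_neg h₁₂ hxy hx₁ hy₁ hx₂ hy₂ (Set.smul_mem_smul_set hp)
    (Set.smul_mem_smul_set hp)
  have e₁₃ := h.orientation_mul_neg h₁₃ hxy hx₁ hy₁ hx₃ hy₃ (Set.smul_mem_smul_set hp)
    (Set.smul_mem_smul_set hp)
  have e₂₃ := h.orientation_mul_neg h₂₃ hxy hx₂ hy₂ hx₃ hy₃ (Set.smul_mem_smul_set hp)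
    (Set.smul_mem_smul_set hp)
  -- Three tiles cannot lie pairwise on opposite sides of one line.
  nlinarith [mul_pos_of_neg_of_neg e₁₂ e₁₃, sq_nonneg (orientation x y (γ₁ • p))]

/-- The tile lies on one side of each of its sides. -/
theorem orientation_mul_nonneg {γ γ' : Γ} (hne : γ ≠ γ') {x y p u : ℍ} (hp : p ∈ F) (hxy : x ≠ y)
    (hx : x ∈ tile F γ) (hy : y ∈ tile F γ) (hx' : x ∈ tile F γ') (hy' : y ∈ tile F γ')
    (hu : u ∈ tile F γ) : 0 ≤ orientation x y (γ • p) * orientation x y u := by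
  rw [tile_eq_closure] at hu
  refine closure_minimal (t := {u | 0 ≤ orientation x y (γ • p) * orientation x y u})
    (fun v hv => ?_) (isClosed_le continuous_const
      (continuous_const.mul (continuous_orientation x y))) hu
  have e₁ := h.orientation_mul_neg hne hxy hx hy hx' hy' (Set.smul_mem_smul_set hp)
    (Set.smul_mem_smul_set hp)
  have e₂ := h.orientation_mul_neg hne hxy hx hy hx' hy' hv (Set.smul_mem_smul_set hp)
  by_contra hcon
  have hcon : orientation x y (γ • p) * orientation x y v < 0 := not_le.1 hcon
  nlinarith [mul_pos_of_neg_of_neg e₁ e₂, sq_nonneg (orientation x y (γ' • p))]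

theorem orientation_ne_zero {γ γ' : Γ} (hne : γ ≠ γ') {x y p : ℍ} (hp : p ∈ F) (hxy : x ≠ y)
    (hx : x ∈ tile F γ) (hy : y ∈ tile F γ) (hx' : x ∈ tile F γ') (hy' : y ∈ tile F γ') :
    orientation x y (γ • p) ≠ 0 :=
  left_ne_zero_of_mul (h.orientation_mul_neg hne hxy hx hy hx' hy' (Set.smul_mem_smul_set hp)
    (Set.smul_mem_smul_set (a := γ') hp)).ne

/-- Two sides of a tile which leave `z` with the tile on the same hand have the same direction. -/
theorem exists_pos_smul {γ γ' γ'' : Γ} (hne : γ ≠ γ') (hne' : γ ≠ γ'') {p z y y' : ℍ} (hp : p ∈ F)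
    (hz : z ∈ tile F γ) (hz' : z ∈ tile F γ') (hz'' : z ∈ tile F γ'')
    (hy : y ∈ tile F γ) (hy' : y ∈ tile F γ') (hyy : y' ∈ tile F γ) (hyy' : y' ∈ tile F γ'')
    (ho : 0 < orientation z y (γ • p) * orientation z y' (γ • p)) :
    ∃ t : ℝ, 0 < t ∧ kleinMap y' - kleinMap z = t • (kleinMap y - kleinMap z) := by
  have hself : ∀ u v : ℍ, orientation u u v = 0 := fun u v => by simp [orientation, cross]
  have hzy : z ≠ y := by rintro rfl; simp [hself] at ho
  have hzy' : z ≠ y' := by rintro rfl; simp [hself] at ho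
  have e₁ := h.orientation_mul_nonneg hne hp hzy hz hy hz' hy' hyy
  have e₂ := h.orientation_mul_nonneg hne' hp hzy' hz hyy hz'' hyy' hy
  have e₃ : orientation z y' y = -orientation z y y' := by unfold orientation cross; ring
  rw [e₃] at e₂
  -- Each of `y`, `y'` lies on the tile's side of the line through `z` and the other; for equal
  -- hands these two conditions have opposite signs.
  have e₄ : orientation z y y' = 0 := by
    by_contra hcon
    nlinarith [mul_nonneg e₁ e₂, mul_pos ho (sq_pos_of_ne_zero hcon)]
  have hne : kleinMap z ≠ kleinMap y := fun h => hzy (isOpenEmbedding_kleinMap.injective h)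
  set d := kleinMap y - kleinMap z with hd
  set e := kleinMap y' - kleinMap z with he
  have hcr : d.1 * e.2 - d.2 * e.1 = 0 := e₄
  have hd0 : 0 < d.1 ^ 2 + d.2 ^ 2 := by
    by_contra! hcon
    apply hne
    have : d = 0 := by
      apply Prod.ext <;> simp only [Prod.fst_zero, Prod.snd_zero] <;>
        nlinarith [sq_nonneg d.1, sq_nonneg d.2]
    exact (sub_eq_zero.1 this).symm
  set t := (d.1 * e.1 + d.2 * e.2) / (d.1 ^ 2 + d.2 ^ 2) with ht
  have ht' : t * (d.1 ^ 2 + d.2 ^ 2) = d.1 * e.1 + d.2 * e.2 := by rw [ht]; field_simp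
  have h1 : e.1 = t * d.1 := by
    apply mul_right_cancel₀ hd0.ne'
    linear_combination (-d.1) * ht' - d.2 * hcr
  have h2 : e.2 = t * d.2 := by
    apply mul_right_cancel₀ hd0.ne'
    linear_combination (-d.2) * ht' + d.1 * hcr
  refine ⟨t, ?_, Prod.ext h1 h2⟩
  have h3 : orientation z y' (γ • p) = t * orientation z y (γ • p) := by
    show e.1 * _ - e.2 * _ = t * (d.1 * _ - d.2 * _)
    rw [h1, h2]; ring
  rw [h3] at ho
  by_contra! hcon
  nlinarith [sq_nonneg (orientation z y (γ • p))]

/-- The two sides have the same direction at `z`, so the nearer of `y` and `y'` lies in all three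
tiles. Three distinct tiles share at most one point, and `z` is already one. -/
theorem eq_of_same_hand {γ γ' γ'' : Γ} (hne : γ ≠ γ') (hne' : γ ≠ γ'') {p z y y' : ℍ} (hp : p ∈ F)
    (hz : z ∈ tile F γ) (hz' : z ∈ tile F γ') (hz'' : z ∈ tile F γ'')
    (hy : y ∈ tile F γ) (hy' : y ∈ tile F γ') (hyy : y' ∈ tile F γ) (hyy' : y' ∈ tile F γ'')
    (ho : 0 < orientation z y (γ • p) * orientation z y' (γ • p)) : γ' = γ'' := by
  by_contra hcon
  have hself : ∀ u v : ℍ, orientation u u v = 0 := fun u v => by simp [orientation, cross]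
  have hzy : z ≠ y := by rintro rfl; simp [hself] at ho
  have hzy' : z ≠ y' := by rintro rfl; simp [hself] at ho
  obtain ⟨t, ht, e⟩ := h.exists_pos_smul hne hne' hp hz hz' hz'' hy hy' hyy hyy' ho
  rcases le_total t 1 with h1 | h1
  · have hs : kleinMap y' ∈ segment ℝ (kleinMap z) (kleinMap y) :=
      ⟨1 - t, t, by linarith, ht.le, by ring, by
        rw [sub_eq_iff_eq_add.1 e]; module⟩
    exact hzy' (h.subsingleton_of_three hne hne' hcon hz hz' hz'' hyy
      (h.mem_tile_of_mem_segment hz' hy' hs) hyy')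
  · have hs : kleinMap y ∈ segment ℝ (kleinMap z) (kleinMap y') :=
      ⟨1 - t⁻¹, t⁻¹, by simpa using inv_le_one_of_one_le₀ h1, by positivity, by ring, by
        have : kleinMap y - kleinMap z = t⁻¹ • (kleinMap y' - kleinMap z) := by
          rw [e, smul_smul, inv_mul_cancel₀ ht.ne', one_smul]
        rw [sub_eq_iff_eq_add.1 this]; module⟩
    exact hzy (h.subsingleton_of_three hne hne' hcon hz hz' hz'' hy hy'
      (h.mem_tile_of_mem_segment hz'' hyy' hs))

end IsFundamentalPolygon

end Tessellation

/-! ### Coboundaries on a finite cycle -/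

section Perm

/-- On a finite cycle, a function with vanishing sum is a coboundary. -/
theorem exists_potential_of_sameCycle {α : Type*} [Fintype α] (π : Equiv.Perm α)
    (hπ : ∀ a b, π.SameCycle a b) (φ : α → ℝ) (hφ : ∑ a, φ a = 0) :
    ∃ u : α → ℝ, ∀ a, u (π a) - u a = φ a := by
  classical
  let T : (α → ℝ) →ₗ[ℝ] (α → ℝ) := LinearMap.funLeft ℝ ℝ π - LinearMap.id
  have hT : ∀ u a, T u a = u (π a) - u a := fun u a => rfl
  by_contra hcon
  have hmem : φ ∉ LinearMap.range T := by
    rintro ⟨u, hu⟩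
    exact hcon ⟨u, fun a => by rw [← hT, hu]⟩
  -- A functional killing all coboundaries has invariant weights, which are constant on a single
  -- cycle; it then kills every `φ` of sum zero.
  obtain ⟨f, hf, hfT⟩ := Submodule.exists_le_ker_of_notMem hmem
  let w : α → ℝ := fun a => f (Pi.single a 1)
  have hfw : ∀ v : α → ℝ, f v = ∑ a, v a * w a := fun v => by
    rw [LinearMap.pi_apply_eq_sum_univ f v]
    refine Finset.sum_congr rfl fun a _ => ?_
    rw [smul_eq_mul]
    refine congr_arg _ (congr_arg f (funext fun l => ?_))
    simp [Pi.single_apply, eq_comm]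
  have hstep : ∀ a, w (π a) = w a := by
    intro a
    have h0 : f (T (Pi.single (π a) 1)) = 0 := hfT ⟨_, rfl⟩
    have h1 : T (Pi.single (π a) 1) = Pi.single a 1 - Pi.single (π a) 1 := by
      funext b
      rw [hT]
      simp [Pi.single_apply]
    rw [h1, map_sub, sub_eq_zero] at h0
    exact h0.symm
  have hconst : ∀ a b, w a = w b := by
    intro a b
    obtain ⟨n, hn⟩ := hπ a b
    have hz : ∀ m : ℕ, ∀ c, w ((π ^ m) c) = w c := by
      intro m
      induction m with
      | zero => simp
      | succ m ih => intro c; rw [pow_succ, Equiv.Perm.mul_apply, ih, hstep]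
    rcases n with m | m
    · rw [← hn, Int.ofNat_eq_natCast, zpow_natCast, hz]
    · rw [← hn, zpow_negSucc]
      have := hz (m + 1) ((π ^ (m + 1))⁻¹ a)
      rw [← Equiv.Perm.mul_apply, mul_inv_cancel, Equiv.Perm.one_apply] at this
      exact this
  apply hf
  rcases isEmpty_or_nonempty α with hα | ⟨⟨a₀⟩⟩
  · rw [hfw]; simp
  · rw [hfw]
    simp_rw [fun a => hconst a a₀]
    rw [← Finset.sum_mul, hφ, zero_mul]

end Perm

/-! ### The cyclic order of the tiles around a point, and local potentials -/

section Tessellation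

variable {Γ : Subgroup PSL(2, ℝ)} {F : Set ℍ}

open Classical in
/-- The skew-symmetric incidence number of two tiles at `z`. -/
noncomputable def incidence (F : Set ℍ) (p z : ℍ) (γ γ' : Γ) : ℝ :=
  (if Follows F p z γ γ' then 1 else 0) - (if Follows F p z γ' γ then 1 else 0)

theorem incidence_smul (δ : Γ) (p z : ℍ) (γ γ' : Γ) :
    incidence F p (δ • z) (δ * γ) (δ * γ') = incidence F p z γ γ' := by
  unfold incidence
  classical
  congr 1 <;> exact if_congr (follows_smul δ) rfl rfl

theorem incidence_swap (p z : ℍ) (γ γ' : Γ) :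
    incidence F p z γ' γ = -incidence F p z γ γ' := by
  simp only [incidence]; ring

namespace IsFundamentalPolygon

variable (h : IsFundamentalPolygon Γ F)
include h

theorem finite_tiles (z : ℍ) : {γ : Γ | z ∈ tile F γ}.Finite := by
  refine (h.locallyFinite {z} isCompact_singleton).subset fun γ hγ => ?_
  exact ⟨z, hγ, rfl⟩

/-- The tiles through `z`. -/
noncomputable def tilesAt (z : ℍ) : Finset Γ := (h.finite_tiles z).toFinset

theorem mem_tilesAt {z : ℍ} {γ : Γ} : γ ∈ h.tilesAt z ↔ z ∈ tile F γ := by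
  simp [tilesAt]

theorem exists_mem_tile (z : ℍ) : ∃ γ : Γ, z ∈ tile F γ := by
  obtain ⟨γ, hγ⟩ := h.covers z
  exact ⟨γ⁻¹, by rwa [mem_tile, inv_inv]⟩

/-- By local finiteness only finitely many closed tiles come near `z`, and those missing `z` can be
avoided. -/
theorem eventually_tiles (z : ℍ) : ∀ᶠ w in 𝓝 z, ∀ γ : Γ, w ∈ tile F γ → z ∈ tile F γ := by
  obtain ⟨K, hK, hz⟩ := exists_compact_mem_nhds z
  have hfin := h.locallyFinite K hK
  have hev : ∀ᶠ w in 𝓝 z, ∀ γ ∈ {γ : Γ | ((γ • closure F) ∩ K).Nonempty},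
      w ∈ tile F γ → z ∈ tile F γ := by
    rw [Filter.eventually_all_finite hfin]
    intro γ _
    by_cases hγ : z ∈ tile F γ
    · exact Filter.Eventually.of_forall fun _ _ => hγ
    · filter_upwards [(isClosed_tile γ).isOpen_compl.mem_nhds hγ] with w hw hw'
      exact absurd hw' hw
  filter_upwards [hev, hz] with w hw hwK γ hγ
  exact hw γ ⟨w, hγ, hwK⟩ hγ

/-- If the tiles through `z` are divided into two classes, then there are tiles in different
classes with a common side through `z`, which does not lie on a given ray. -/
theorem exists_common_side {z r : ℍ} (hzr : z ≠ r) (P : Γ → Prop) {γ₀ γ₁ : Γ}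
    (h₀ : z ∈ tile F γ₀) (hP₀ : P γ₀) (h₁ : z ∈ tile F γ₁) (hP₁ : ¬ P γ₁) :
    ∃ γ γ' : Γ, P γ ∧ ¬ P γ' ∧ z ∈ tile F γ ∧ z ∈ tile F γ' ∧ ∃ y, y ∈ tile F γ ∧ y ∈ tile F γ' ∧
      ∀ t : ℝ, 0 ≤ t → kleinMap y - kleinMap z ≠ t • (kleinMap r - kleinMap z) := by
  obtain ⟨y, ⟨hyA, hyB⟩, hy⟩ := exists_mem_inter_not_mem_ray hzr
    (A := ⋃ γ ∈ {γ : Γ | z ∈ tile F γ ∧ P γ}, tile F γ)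
    (B := ⋃ γ ∈ {γ : Γ | z ∈ tile F γ ∧ ¬ P γ}, tile F γ)
    (h.eventually_tiles z)
    (((h.finite_tiles z).subset fun γ hγ => hγ.1).isClosed_biUnion fun γ _ => isClosed_tile γ)
    (((h.finite_tiles z).subset fun γ hγ => hγ.1).isClosed_biUnion fun γ _ => isClosed_tile γ)
    (fun w hw => by
      obtain ⟨γ, hγ⟩ := h.exists_mem_tile w
      by_cases hP : P γ
      · exact Or.inl (Set.mem_biUnion (show γ ∈ {γ : Γ | z ∈ tile F γ ∧ P γ} from ⟨hw γ hγ, hP⟩) hγ)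
      · exact Or.inr (Set.mem_biUnion
          (show γ ∈ {γ : Γ | z ∈ tile F γ ∧ ¬ P γ} from ⟨hw γ hγ, hP⟩) hγ))
    (h.isOpen_smul γ₀) (h.isOpen_smul γ₁)
    ((smul_subset_tile γ₀).trans
      (Set.subset_biUnion_of_mem (show γ₀ ∈ {γ : Γ | z ∈ tile F γ ∧ P γ} from ⟨h₀, hP₀⟩)))
    ((smul_subset_tile γ₁).trans
      (Set.subset_biUnion_of_mem (show γ₁ ∈ {γ : Γ | z ∈ tile F γ ∧ ¬ P γ} from ⟨h₁, hP₁⟩)))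
    (by rwa [← tile_eq_closure]) (by rwa [← tile_eq_closure])
  simp only [Set.mem_iUnion, exists_prop] at hyA hyB
  obtain ⟨γ, ⟨hzγ, hPγ⟩, hyγ⟩ := hyA
  obtain ⟨γ', ⟨hzγ', hPγ'⟩, hyγ'⟩ := hyB
  exact ⟨γ, γ', hPγ, hPγ', hzγ, hzγ', y, hyγ, hyγ', hy⟩

theorem follows_or_follows {γ γ' : Γ} (hne : γ ≠ γ') {p z y : ℍ} (hp : p ∈ F) (hzy : z ≠ y)
    (hz : z ∈ tile F γ) (hz' : z ∈ tile F γ') (hy : y ∈ tile F γ) (hy' : y ∈ tile F γ') :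
    Follows F p z γ γ' ∨ Follows F p z γ' γ := by
  have e := h.orientation_mul_neg hne hzy hz hy hz' hy' (Set.smul_mem_smul_set hp)
    (Set.smul_mem_smul_set hp)
  rcases mul_neg_iff.1 e with ⟨-, e⟩ | ⟨e, -⟩
  · exact Or.inr ⟨hne.symm, hz', hz, y, hy', hy, e⟩
  · exact Or.inl ⟨hne, hz, hz', y, hy, hy', e⟩

theorem follows_or_follows_of_adjacent {γ γ' : Γ} (hadj : Adjacent F γ γ') {p z : ℍ} (hp : p ∈ F)
    (hz : z ∈ tile F γ) (hz' : z ∈ tile F γ') :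
    Follows F p z γ γ' ∨ Follows F p z γ' γ := by
  obtain ⟨y, ⟨hy, hy'⟩, hyz⟩ := hadj.2.exists_ne z
  exact h.follows_or_follows hadj.1 hp hyz.symm hz hz' hy hy'

/-- Functions on the tiles through `z` which do not jump across sides are constant. -/
theorem eq_of_forall_adjacent {z : ℍ} {β : Type*} (k : Γ → β)
    (hk : ∀ γ γ', z ∈ tile F γ → z ∈ tile F γ' → Adjacent F γ γ' → k γ = k γ') {γ₀ γ₁ : Γ}
    (h₀ : z ∈ tile F γ₀) (h₁ : z ∈ tile F γ₁) : k γ₀ = k γ₁ := by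
  by_contra hcon
  obtain ⟨r, hr⟩ := exists_ne z
  obtain ⟨γ, γ', hP, hP', hz, hz', y, hy, hy', hray⟩ := h.exists_common_side hr.symm
    (fun γ => k γ = k γ₀) h₀ rfl h₁ (fun e => hcon e.symm)
  refine hP' ((hk γ γ' hz hz' ⟨?_, z, ⟨hz, hz'⟩, y, ⟨hy, hy'⟩, ?_⟩).symm.trans hP)
  · rintro rfl; exact hP' hP
  · rintro rfl; exact hray 0 le_rfl (by simp)

theorem follows_unique {γ γ' γ'' : Γ} {p z : ℍ} (hp : p ∈ F) (h' : Follows F p z γ γ')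
    (h'' : Follows F p z γ γ'') : γ' = γ'' := by
  obtain ⟨hne, hz, hz', y, hy, hy', ho⟩ := h'
  obtain ⟨hne', -, hz'', y', hyy, hyy', ho'⟩ := h''
  exact h.eq_of_same_hand hne hne' hp hz hz' hz'' hy hy' hyy hyy' (mul_pos_of_neg_of_neg ho ho')

theorem follows_injective {γ γ' γ'' : Γ} {p z : ℍ} (hp : p ∈ F) (h' : Follows F p z γ' γ)
    (h'' : Follows F p z γ'' γ) : γ' = γ'' := by
  obtain ⟨hne, hz', hz, y, hy', hy, ho⟩ := h'
  obtain ⟨hne', hz'', -, y', hyy', hyy, ho'⟩ := h''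
  have hself : ∀ u v : ℍ, orientation u u v = 0 := fun u v => by simp [orientation, cross]
  have hzy : z ≠ y := by rintro rfl; simp [hself] at ho
  have hzy' : z ≠ y' := by rintro rfl; simp [hself] at ho'
  have e := h.orientation_mul_neg hne hzy hz' hy' hz hy (Set.smul_mem_smul_set hp)
    (Set.smul_mem_smul_set hp)
  have e' := h.orientation_mul_neg hne' hzy' hz'' hyy' hz hyy (Set.smul_mem_smul_set hp)
    (Set.smul_mem_smul_set hp)
  refine h.eq_of_same_hand hne.symm hne'.symm hp hz hz' hz'' hy hy' hyy hyy' (mul_pos ?_ ?_)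
  · exact pos_of_mul_neg_right e ho.le
  · exact pos_of_mul_neg_right e' ho'.le

/-- The tile has two sides at `z`. If the first one found has the wrong hand, a second is sought off
the ray through it; were its hand also wrong, both would have the same direction. -/
theorem exists_follows {γ γ₁ : Γ} (hne : γ ≠ γ₁) {p z : ℍ} (hp : p ∈ F) (hz : z ∈ tile F γ)
    (hz₁ : z ∈ tile F γ₁) : ∃ γ', Follows F p z γ γ' := by
  obtain ⟨r, hr⟩ := exists_ne z
  obtain ⟨_, γ', rfl, hP', -, hz', y, hy, hy', hray⟩ := h.exists_common_side hr.symm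
    (fun δ => δ = γ) hz rfl hz₁ (fun e => hne e.symm)
  have hzy : z ≠ y := by rintro rfl; exact hray 0 le_rfl (by simp)
  have hne' := Ne.symm hP'
  rcases lt_or_gt_of_ne (h.orientation_ne_zero hne' hp hzy hz hy hz' hy') with ho | ho
  · exact ⟨γ', hne', hz, hz', y, hy, hy', ho⟩
  obtain ⟨_, γ'', rfl, hP'', -, hz'', y', hyy, hyy', hray'⟩ := h.exists_common_side hzy
    (fun δ => δ = _) hz rfl hz₁ (fun e => hne e.symm)
  have hzy' : z ≠ y' := by rintro rfl; exact hray' 0 le_rfl (by simp)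
  have hne'' := Ne.symm hP''
  rcases lt_or_gt_of_ne (h.orientation_ne_zero hne'' hp hzy' hz hyy hz'' hyy') with ho' | ho'
  · exact ⟨γ'', hne'', hz, hz'', y', hyy, hyy', ho'⟩
  obtain ⟨t, ht, e⟩ := h.exists_pos_smul hne' hne'' hp hz hz' hz'' hy hy' hyy hyy' (mul_pos ho ho')
  exact absurd e (hray' t ht.le)

/-- The cyclic order of the tiles through `z`. -/
theorem exists_perm_follows {p z : ℍ} (hp : p ∈ F) {γ₀ γ₁ : Γ} (hne : γ₀ ≠ γ₁)
    (h₀ : z ∈ tile F γ₀) (h₁ : z ∈ tile F γ₁) :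
    ∃ π : Equiv.Perm (h.tilesAt z),
      (∀ γ γ' : h.tilesAt z, Follows F p z (γ : Γ) γ' ↔ π γ = γ') ∧ ∀ γ γ', π.SameCycle γ γ' := by
  classical
  have hex : ∀ γ : h.tilesAt z, ∃ γ' : h.tilesAt z, Follows F p z (γ : Γ) γ' := by
    rintro ⟨γ, hγ⟩
    rw [mem_tilesAt] at hγ
    obtain ⟨γ', hγ'⟩ : ∃ γ', Follows F p z γ γ' := by
      by_cases e : γ = γ₀
      · exact h.exists_follows (e ▸ hne) hp hγ h₁
      · exact h.exists_follows e hp hγ h₀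
    exact ⟨⟨γ', h.mem_tilesAt.2 hγ'.2.2.1⟩, hγ'⟩
  choose nx hnx using hex
  have hinj : Function.Injective nx := fun γ γ' e =>
    Subtype.ext (h.follows_injective hp (hnx γ) (e ▸ hnx γ'))
  let π : Equiv.Perm (h.tilesAt z) := Equiv.ofBijective nx (Finite.injective_iff_bijective.1 hinj)
  have hπ : ∀ γ γ' : h.tilesAt z, Follows F p z (γ : Γ) γ' ↔ π γ = γ' := fun γ γ' =>
    ⟨fun hf => Subtype.ext (h.follows_unique hp (hnx γ) hf), fun e => e ▸ hnx γ⟩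
  refine ⟨π, hπ, fun γ γ' => ?_⟩
  -- Adjacent tiles at `z` are neighbours in the permutation, so membership in one of its cycles
  -- does not change across sides.
  have := h.eq_of_forall_adjacent (z := z)
    (fun δ => ∃ hδ : δ ∈ h.tilesAt z, π.SameCycle γ ⟨δ, hδ⟩) (fun δ δ' hδ hδ' hadj => ?_)
    (h.mem_tilesAt.1 γ.2) (h.mem_tilesAt.1 γ'.2)
  · exact (this.mp ⟨γ.2, Equiv.Perm.SameCycle.refl _ _⟩).2
  · have hsc : π.SameCycle ⟨δ, h.mem_tilesAt.2 hδ⟩ ⟨δ', h.mem_tilesAt.2 hδ'⟩ := by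
      rcases h.follows_or_follows_of_adjacent hadj hp hδ hδ' with hf | hf
      · exact ⟨1, by rw [zpow_one]; exact (hπ ⟨δ, _⟩ ⟨δ', _⟩).1 hf⟩
      · exact Equiv.Perm.SameCycle.symm ⟨1, by rw [zpow_one]; exact (hπ ⟨δ', _⟩ ⟨δ, _⟩).1 hf⟩
    exact propext ⟨fun ⟨_, hs⟩ => ⟨h.mem_tilesAt.2 hδ', hs.trans hsc⟩,
      fun ⟨_, hs⟩ => ⟨h.mem_tilesAt.2 hδ, hs.trans hsc.symm⟩⟩

/-- The two halves of the incidence number run around the cycle in opposite directions; as `f` is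
odd they contribute equally. -/
theorem sum_incidence_eq {p z : ℍ} {π : Equiv.Perm (h.tilesAt z)}
    (hπ : ∀ γ γ' : h.tilesAt z, Follows F p z (γ : Γ) γ' ↔ π γ = γ') (f : Γ → ℝ)
    (hf : ∀ σ, f σ⁻¹ = -f σ) :
    ∑ γ ∈ h.tilesAt z, ∑ γ' ∈ h.tilesAt z, incidence F p z γ γ' * f (γ⁻¹ * γ') =
      2 * ∑ γ : h.tilesAt z, f ((γ : Γ)⁻¹ * π γ) := by
  classical
  have e₁ : ∑ γ : h.tilesAt z, ∑ γ' : h.tilesAt z,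
      (if Follows F p z (γ : Γ) γ' then (1 : ℝ) else 0) * f ((γ : Γ)⁻¹ * γ') =
      ∑ γ : h.tilesAt z, f ((γ : Γ)⁻¹ * π γ) := by
    refine Finset.sum_congr rfl fun γ _ => ?_
    simp [hπ]
  have e₂ : ∑ γ : h.tilesAt z, ∑ γ' : h.tilesAt z,
      (if Follows F p z (γ' : Γ) γ then (1 : ℝ) else 0) * f ((γ : Γ)⁻¹ * γ') =
      -∑ γ : h.tilesAt z, f ((γ : Γ)⁻¹ * π γ) := by
    rw [Finset.sum_comm, ← e₁, ← Finset.sum_neg_distrib]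
    refine Finset.sum_congr rfl fun γ _ => ?_
    rw [← Finset.sum_neg_distrib]
    refine Finset.sum_congr rfl fun γ' _ => ?_
    rw [← mul_neg, ← hf, mul_inv_rev, inv_inv]
  simp_rw [← Finset.sum_coe_sort (h.tilesAt z)]
  simp only [incidence, sub_mul, Finset.sum_sub_distrib]
  rw [e₁, e₂]
  ring

/-- For a homomorphism the sum around the cycle telescopes. -/
theorem sum_incidence_hom {p : ℍ} (hp : p ∈ F) (z : ℍ) (χ : Γ → ℝ)
    (hχ : ∀ γ γ', χ (γ * γ') = χ γ + χ γ') :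
    ∑ γ ∈ h.tilesAt z, ∑ γ' ∈ h.tilesAt z, incidence F p z γ γ' * χ (γ⁻¹ * γ') = 0 := by
  have h1 : χ 1 = 0 := by simpa using hχ 1 1
  have hinv : ∀ σ, χ σ⁻¹ = -χ σ := fun σ => by
    have := hχ σ⁻¹ σ
    rw [inv_mul_cancel, h1] at this
    linarith
  by_cases hT : ∃ γ₀ γ₁ : Γ, γ₀ ≠ γ₁ ∧ z ∈ tile F γ₀ ∧ z ∈ tile F γ₁
  · obtain ⟨γ₀, γ₁, hne, h₀, h₁⟩ := hT
    obtain ⟨π, hπ, -⟩ := h.exists_perm_follows hp hne h₀ h₁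
    rw [h.sum_incidence_eq hπ χ hinv]
    simp only [hχ, hinv, Finset.sum_add_distrib, Finset.sum_neg_distrib]
    rw [Equiv.sum_comp π (fun γ : h.tilesAt z => χ γ)]
    ring
  · push Not at hT
    refine Finset.sum_eq_zero fun γ hγ => Finset.sum_eq_zero fun γ' hγ' => ?_
    rw [mem_tilesAt] at hγ hγ'
    by_cases e : γ = γ'
    · rw [e, inv_mul_cancel, h1, mul_zero]
    · exact absurd hγ' (hT γ γ' e hγ)

/-- The local potentials. -/
theorem exists_local_potential {p : ℍ} (hp : p ∈ F) (z : ℍ) (f : Γ → ℝ) (hf : ∀ σ, f σ⁻¹ = -f σ)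
    (hsum : ∑ γ ∈ h.tilesAt z, ∑ γ' ∈ h.tilesAt z, incidence F p z γ γ' * f (γ⁻¹ * γ') = 0) :
    ∃ u : Γ → ℝ, ∀ γ γ', z ∈ tile F γ → z ∈ tile F γ' → Adjacent F γ γ' →
      u γ' - u γ = f (γ⁻¹ * γ') := by
  classical
  by_cases hT : ∃ γ₀ γ₁ : Γ, γ₀ ≠ γ₁ ∧ z ∈ tile F γ₀ ∧ z ∈ tile F γ₁
  · obtain ⟨γ₀, γ₁, hne, h₀, h₁⟩ := hT
    obtain ⟨π, hπ, hc⟩ := h.exists_perm_follows hp hne h₀ h₁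
    rw [h.sum_incidence_eq hπ f hf] at hsum
    obtain ⟨u, hu⟩ := exists_potential_of_sameCycle π hc (fun γ => f ((γ : Γ)⁻¹ * π γ))
      (by simpa using hsum)
    refine ⟨fun γ => if hγ : γ ∈ h.tilesAt z then u ⟨γ, hγ⟩ else 0, fun γ γ' hγ hγ' hadj => ?_⟩
    beta_reduce
    rw [dif_pos (h.mem_tilesAt.2 hγ), dif_pos (h.mem_tilesAt.2 hγ')]
    rcases h.follows_or_follows_of_adjacent hadj hp hγ hγ' with hfo | hfo
    · have e := (hπ ⟨γ, h.mem_tilesAt.2 hγ⟩ ⟨γ', h.mem_tilesAt.2 hγ'⟩).1 hfo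
      have := hu ⟨γ, h.mem_tilesAt.2 hγ⟩
      rwa [e] at this
    · have e := (hπ ⟨γ', h.mem_tilesAt.2 hγ'⟩ ⟨γ, h.mem_tilesAt.2 hγ⟩).1 hfo
      have := hu ⟨γ', h.mem_tilesAt.2 hγ'⟩
      rw [e] at this
      have e' := hf (γ⁻¹ * γ')
      rw [mul_inv_rev, inv_inv] at e'
      simp only at this
      linarith
  · push Not at hT
    exact ⟨0, fun γ γ' hγ hγ' hadj => absurd hγ' (hT γ γ' hadj.1 hγ)⟩

end IsFundamentalPolygon

end Tessellation

/-! ### From vertex relations to homomorphisms -/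

section Tessellation

variable {Γ : Subgroup PSL(2, ℝ)} {F : Set ℍ}

theorem adjacent_mul_left (δ : Γ) {γ γ' : Γ} :
    Adjacent F (δ * γ) (δ * γ') ↔ Adjacent F γ γ' := by
  have e : tile F (δ * γ) ∩ tile F (δ * γ') = (fun z => δ • z) '' (tile F γ ∩ tile F γ') := by
    rw [Set.image_smul, Set.smul_set_inter]
    simp only [tile, mul_smul]
  rw [Adjacent, Adjacent, Ne, mul_right_inj, e, Set.image_nontrivial (MulAction.injective δ)]

namespace IsFundamentalPolygon

variable (h : IsFundamentalPolygon Γ F)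
include h

/-- Any two tiles are connected by a chain of adjacent tiles. -/
theorem eq_of_adjacent {β : Type*} (k : Γ → β) (hk : ∀ γ γ', Adjacent F γ γ' → k γ = k γ')
    (γ₀ γ₁ : Γ) : k γ₀ = k γ₁ := by
  choose c hc using h.exists_mem_tile
  have hloc : IsLocallyConstant fun w => k (c w) := by
    rw [IsLocallyConstant.iff_eventually_eq]
    intro z
    filter_upwards [h.eventually_tiles z] with w hw
    exact h.eq_of_forall_adjacent k (fun γ γ' _ _ => hk γ γ') (hw _ (hc w)) (hc z)
  obtain ⟨p, hp⟩ := h.isConnected.nonempty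
  have htile : ∀ γ : Γ, k γ = k (c (γ • p)) := fun γ =>
    h.eq_of_forall_adjacent k (fun γ γ' _ _ => hk γ γ')
      (smul_subset_tile γ (Set.smul_mem_smul_set hp)) (hc _)
  rw [htile γ₀, htile γ₁]
  exact hloc.apply_eq_of_preconnectedSpace _ _

theorem isPreconnected_tile (γ : Γ) : IsPreconnected (tile F γ) := by
  rw [tile_eq_closure, ← Set.image_smul]
  exact (h.isConnected.isPreconnected.image _ (continuous_const_smul γ).continuousOn).closure

/-- A function on the side pairings which satisfies the relations at all points extends to a
homomorphism. -/
theorem exists_hom {p : ℍ} (hp : p ∈ F) (f : Γ → ℝ) (hf : ∀ σ, f σ⁻¹ = -f σ)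
    (hsum : ∀ z,
      ∑ γ ∈ h.tilesAt z, ∑ γ' ∈ h.tilesAt z, incidence F p z γ γ' * f (γ⁻¹ * γ') = 0) :
    ∃ χ : Γ → ℝ, (∀ γ γ', χ (γ * γ') = χ γ + χ γ') ∧ ∀ σ, Adjacent F 1 σ → χ σ = f σ := by
  choose u hu using fun z => h.exists_local_potential hp z f hf (hsum z)
  choose c hc using h.exists_mem_tile
  -- The potentials at nearby points have the same jumps across sides, so they differ by a constant
  -- on their common tiles. This makes the function in the next step a local cocycle.
  have hdiff : ∀ x y γ γ', (∀ δ : Γ, y ∈ tile F δ → x ∈ tile F δ) → y ∈ tile F γ →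
      y ∈ tile F γ' → u x γ - u y γ = u x γ' - u y γ' := by
    intro x y γ γ' hxy hγ hγ'
    refine h.eq_of_forall_adjacent (fun γ => u x γ - u y γ) (fun γ γ' hγ hγ' hadj => ?_) hγ hγ'
    have e₁ := hu x γ γ' (hxy _ hγ) (hxy _ hγ') hadj
    have e₂ := hu y γ γ' hγ hγ' hadj
    linarith
  obtain ⟨G, hG⟩ := exists_primitive (fun x y => u x (c y) - u x (c x)) (fun x => by
    filter_upwards [h.eventually_tiles x] with y hy
    filter_upwards [h.eventually_tiles y] with y' hy'
    have := hdiff x y (c y) (c y') hy (hc y) (hy' _ (hc y'))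
    linarith)
  -- The primitive `G` corrects the local potentials so that the value assigned to a tile no longer
  -- depends on the point of the tile.
  have hconst : ∀ γ : Γ, ∀ x ∈ tile F γ, ∀ y ∈ tile F γ,
      G x + u x γ - u x (c x) = G y + u y γ - u y (c y) := by
    intro γ
    have : PreconnectedSpace (tile F γ) :=
      isPreconnected_iff_preconnectedSpace.1 (h.isPreconnected_tile γ)
    have hloc : IsLocallyConstant fun w : tile F γ => G w + u w γ - u w (c w) := by
      rw [IsLocallyConstant.iff_eventually_eq]
      rintro ⟨x, hx⟩
      filter_upwards [continuous_subtype_val.continuousAt.eventually (hG x),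
        continuous_subtype_val.continuousAt.eventually (h.eventually_tiles x)] with y hy hy'
      have := hdiff x y (c y) γ hy' (hc y) y.2
      linarith
    exact fun x hx y hy => hloc.apply_eq_of_preconnectedSpace ⟨x, hx⟩ ⟨y, hy⟩
  obtain ⟨q, hq⟩ := h.isConnected.nonempty
  let H : Γ → ℝ := fun γ => G (γ • q) + u (γ • q) γ - u (γ • q) (c (γ • q))
  have hH : ∀ γ γ', Adjacent F γ γ' → H γ' - H γ = f (γ⁻¹ * γ') := by
    intro γ γ' hadj
    obtain ⟨w, hw, hw'⟩ := hadj.2.nonempty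
    have hmem : ∀ γ : Γ, γ • q ∈ tile F γ := fun γ =>
      smul_subset_tile γ (Set.smul_mem_smul_set hq)
    have e₁ : H γ = _ := hconst γ _ (hmem γ) w hw
    have e₂ : H γ' = _ := hconst γ' _ (hmem γ') w hw'
    rw [e₁, e₂, ← hu w γ γ' hw hw' hadj]
    ring
  refine ⟨fun γ => H γ - H 1, fun δ γ => ?_, fun σ hσ => ?_⟩
  -- The prescribed jumps depend only on `γ⁻¹ γ'`, so the translate of `H` by `δ` has the same jumps
  -- as `H` and differs from it by a constant.
  · have := h.eq_of_adjacent (fun γ => H (δ * γ) - H γ) (fun γ γ' hadj => by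
      have e₁ := hH _ _ ((adjacent_mul_left δ).2 hadj)
      have e₂ := hH _ _ hadj
      rw [mul_inv_rev, mul_assoc, inv_mul_cancel_left] at e₁
      linarith) γ 1
    simp only [mul_one] at this
    linarith
  · have := hH 1 σ hσ
    rwa [inv_one, one_mul] at this

end IsFundamentalPolygon

end Tessellation

/-! ### Functionals on singular homology from local cocycles -/

section SingularChains

open Simplicial Limits

instance (n : ℕ) : LocallyPathConnectedSpace (stdSimplex ℝ (Fin (n + 1))) :=
  (convex_stdSimplex ℝ _).locallyPathConnectedSpace

instance (n : ℕ) : SimplyConnectedSpace (stdSimplex ℝ (Fin (n + 1))) := by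
  have := (convex_stdSimplex ℝ (Fin (n + 1))).contractibleSpace Set.Nonempty.of_subtype
  infer_instance

variable {X : Type} [TopologicalSpace X]

/-- A face of a singular simplex. -/
noncomputable def simplexFace {n : ℕ} (s : C(stdSimplex ℝ (Fin (n + 2)), X)) (i : Fin (n + 2)) :
    C(stdSimplex ℝ (Fin (n + 1)), X) :=
  s.comp ⟨_, stdSimplex.continuous_map i.succAbove⟩

/-- A singular simplex as a generator of the singular chain complex. -/
noncomputable def simplexChain {n : ℕ} (s : C(stdSimplex ℝ (Fin (n + 1)), X)) :
    ModuleCat.of ℝ ℝ ⟶ (realChains X).X n :=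
  SSet.ιChainComplex (TopCat.toSSet.obj (TopCat.of X))
    ((TopCat.toSSetObjEquiv (TopCat.of X) (.op ⦋n⦌)).symm s)

theorem simplexChain_d (s : C(stdSimplex ℝ (Fin 3), X)) :
    simplexChain s ≫ (realChains X).d 2 1 =
      simplexChain (simplexFace s 0) - simplexChain (simplexFace s 1) +
        simplexChain (simplexFace s 2) := by
  refine (SSet.ιChainComplex_d (TopCat.toSSet.obj (TopCat.of X)) (ModuleCat.of ℝ ℝ) _).trans ?_
  rw [Fin.sum_univ_three]
  simp only [Fin.val_zero, pow_zero, one_smul, Fin.val_one, pow_one, neg_smul, Fin.val_two,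
    even_two, Even.neg_pow, one_pow, sub_eq_add_neg]
  rfl

theorem realChains_hom_ext {n : ℕ} {T : ModuleCat.{0} ℝ} {f g : (realChains X).X n ⟶ T}
    (h : ∀ s : C(stdSimplex ℝ (Fin (n + 1)), X), simplexChain s ≫ f = simplexChain s ≫ g) :
    f = g := by
  refine SSet.chainComplex_hom_ext fun x => ?_
  have := h (TopCat.toSSetObjEquiv (TopCat.of X) (.op ⦋n⦌) x)
  unfold simplexChain at this
  rwa [Equiv.symm_apply_apply] at this

/-- The singular cochain with given values on simplices. -/
noncomputable def cochainOf {n : ℕ} (c : C(stdSimplex ℝ (Fin (n + 1)), X) → ℝ) :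
    (realChains X).X n ⟶ ModuleCat.of ℝ ℝ :=
  Cofan.IsColimit.desc (SSet.isColimitChainComplexXCofan (TopCat.toSSet.obj (TopCat.of X))
    (ModuleCat.of ℝ ℝ) n)
    fun x => c (TopCat.toSSetObjEquiv (TopCat.of X) _ x) • 𝟙 (ModuleCat.of ℝ ℝ)

theorem simplexChain_cochainOf {n : ℕ} (c : C(stdSimplex ℝ (Fin (n + 1)), X) → ℝ)
    (s : C(stdSimplex ℝ (Fin (n + 1)), X)) :
    simplexChain s ≫ cochainOf c = c s • 𝟙 (ModuleCat.of ℝ ℝ) := by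
  refine (Cofan.IsColimit.fac (SSet.isColimitChainComplexXCofan (TopCat.toSSet.obj (TopCat.of X))
    (ModuleCat.of ℝ ℝ) n) _ _).trans ?_
  rw [Equiv.apply_symm_apply]

/-- A path as a singular simplex. -/
noncomputable def pathSimplex {x y : X} (p : Path x y) : C(stdSimplex ℝ (Fin 2), X) :=
  p.toContinuousMap.comp (toContinuousMap stdSimplexHomeomorphUnitInterval)

theorem pathChain_eq {x y : X} (p : Path x y) : pathChain p = simplexChain (pathSimplex p) := rfl

/-- The class of a singular `1`-simplex modulo boundaries. -/
noncomputable def simplexClass (s : C(stdSimplex ℝ (Fin 2), X)) : (realChains X).opcycles 1 :=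
  (simplexChain s ≫ (realChains X).pOpcycles 1).hom (1 : ℝ)

theorem simplexClass_boundary (s : C(stdSimplex ℝ (Fin 3), X)) :
    simplexClass (simplexFace s 0) - simplexClass (simplexFace s 1) +
      simplexClass (simplexFace s 2) = 0 := by
  have h : (simplexChain s ≫ (realChains X).d 2 1) ≫ (realChains X).pOpcycles 1 = 0 := by simp
  rw [simplexChain_d, Preadditive.add_comp, Preadditive.sub_comp] at h
  have := congr_arg (fun f => ModuleCat.Hom.hom f (1 : ℝ)) h
  exact this

theorem homologyι_loopClass {x : X} (p : Path x x) :
    ((realChains X).homologyι 1).hom (loopClass p) = simplexClass (pathSimplex p) := by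
  unfold loopClass simplexClass
  rw [← pathChain_eq, ← ModuleCat.comp_apply]
  congr 2
  simp

theorem homologyι_injective : Function.Injective ((realChains X).homologyι 1).hom :=
  (ModuleCat.mono_iff_injective _).1 inferInstance

/-- A singular cocycle, given by its values on simplices, defines a functional on homology. -/
theorem exists_functional (c : C(stdSimplex ℝ (Fin 2), X) → ℝ)
    (hc : ∀ s : C(stdSimplex ℝ (Fin 3), X),
      c (simplexFace s 0) - c (simplexFace s 1) + c (simplexFace s 2) = 0) :
    ∃ Φ : RealH1 X →ₗ[ℝ] ℝ, ∀ (x : X) (p : Path x x), Φ (loopClass p) = c (pathSimplex p) := by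
  have hd : (realChains X).d 2 1 ≫ cochainOf c = 0 := by
    refine realChains_hom_ext fun s => ?_
    rw [← Category.assoc, simplexChain_d, Preadditive.add_comp, Preadditive.sub_comp,
      simplexChain_cochainOf, simplexChain_cochainOf, simplexChain_cochainOf, ← sub_smul,
      ← add_smul, hc]
    simp
  refine ⟨(cocyclePairing X ⟨cochainOf c, hd⟩).hom, fun x p => ?_⟩
  have key : ((realChains X).liftCycles (pathChain p) 0 (by simp) (pathChain_d p) ≫
      (realChains X).homologyπ 1) ≫ cocyclePairing X ⟨cochainOf c, hd⟩ =
      c (pathSimplex p) • 𝟙 (ModuleCat.of ℝ ℝ) := by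
    rw [← simplexChain_cochainOf, ← pathChain_eq]
    simp [cocyclePairing]
  have := congr_arg (fun f => ModuleCat.Hom.hom f (1 : ℝ)) key
  refine Eq.trans this ?_
  simp

/-- Two primitives of the same local data differ by a locally constant function. -/
theorem primitive_sub_eq {Y : Type*} [TopologicalSpace Y] [PreconnectedSpace Y] {k : Y → Y → ℝ}
    {G G' : Y → ℝ} (hG : ∀ x, ∀ᶠ y in 𝓝 x, G y - G x = k x y)
    (hG' : ∀ x, ∀ᶠ y in 𝓝 x, G' y - G' x = k x y) (x y : Y) : G y - G x = G' y - G' x := by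
  have hloc : IsLocallyConstant fun y => G y - G' y := by
    rw [IsLocallyConstant.iff_eventually_eq]
    intro x
    filter_upwards [hG x, hG' x] with y h₁ h₂
    linarith
  have := hloc.apply_eq_of_preconnectedSpace x y
  linarith

theorem primitive_comp {Y Z : Type*} [TopologicalSpace Y] [TopologicalSpace Z] {k : Z → Z → ℝ}
    {G : Z → ℝ} (hG : ∀ x, ∀ᶠ y in 𝓝 x, G y - G x = k x y) (s : C(Y, Z)) (x : Y) :
    ∀ᶠ y in 𝓝 x, G (s y) - G (s x) = k (s x) (s y) :=
  s.continuous.continuousAt.eventually (hG (s x))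

/-- A local difference cocycle on `X` defines a functional on homology. -/
theorem exists_functional_of_local (k : X → X → ℝ)
    (hk : ∀ x, ∀ᶠ y in 𝓝 x, ∀ᶠ y' in 𝓝 y, k x y' = k x y + k y y') :
    ∃ Φ : RealH1 X →ₗ[ℝ] ℝ, ∀ (x : X) (p : Path x x) (G : unitInterval → ℝ),
      (∀ t, ∀ᶠ t' in 𝓝 t, G t' - G t = k (p t) (p t')) → Φ (loopClass p) = G 1 - G 0 := by
  have hpull : ∀ {n : ℕ} (s : C(stdSimplex ℝ (Fin (n + 1)), X)),
      ∃ G : stdSimplex ℝ (Fin (n + 1)) → ℝ, ∀ x, ∀ᶠ y in 𝓝 x, G y - G x = k (s x) (s y) := by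
    intro n s
    refine exists_primitive (fun x y => k (s x) (s y)) fun x => ?_
    filter_upwards [s.continuous.continuousAt.eventually (hk (s x))] with y hy
    exact s.continuous.continuousAt.eventually hy
  choose G hG using fun s : C(stdSimplex ℝ (Fin 2), X) => hpull s
  -- The value on an edge is the increment of a primitive pulled back to it. A primitive on a whole
  -- triangle restricts to the three edges, so the alternating sum over the boundary telescopes.
  obtain ⟨Φ, hΦ⟩ := exists_functional
    (fun s => G s (stdSimplex.vertex 1) - G s (stdSimplex.vertex 0)) (fun s => by
      obtain ⟨H, hH⟩ := hpull s
      have hface : ∀ i : Fin 3, G (simplexFace s i) (stdSimplex.vertex 1) -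
          G (simplexFace s i) (stdSimplex.vertex 0) =
          H (stdSimplex.vertex (i.succAbove 1)) - H (stdSimplex.vertex (i.succAbove 0)) := by
        intro i
        rw [← stdSimplex.map_vertex (S := ℝ) i.succAbove 1,
          ← stdSimplex.map_vertex (S := ℝ) i.succAbove 0]
        exact primitive_sub_eq (hG (simplexFace s i))
          (primitive_comp hH ⟨_, stdSimplex.continuous_map i.succAbove⟩) _ _
      rw [hface, hface, hface]
      have e₀ : (0 : Fin 3).succAbove (0 : Fin 2) = 1 := rfl
      have e₁ : (0 : Fin 3).succAbove (1 : Fin 2) = 2 := rfl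
      have e₂ : (1 : Fin 3).succAbove (0 : Fin 2) = 0 := rfl
      have e₃ : (1 : Fin 3).succAbove (1 : Fin 2) = 2 := rfl
      have e₄ : (2 : Fin 3).succAbove (0 : Fin 2) = 0 := rfl
      have e₅ : (2 : Fin 3).succAbove (1 : Fin 2) = 1 := rfl
      rw [e₀, e₁, e₂, e₃, e₄, e₅]
      ring)
  refine ⟨Φ, fun x p g hg => ?_⟩
  rw [hΦ]
  have := primitive_sub_eq (hG (pathSimplex p)) (primitive_comp (k := fun t t' => k (p t) (p t')) hg
    (toContinuousMap stdSimplexHomeomorphUnitInterval)) (stdSimplex.vertex 0) (stdSimplex.vertex 1)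
  rw [this]
  congr 2

end SingularChains

/-! ### Cones over paths in the upper half-plane -/

section Cone

/-- The straight (Euclidean) singular simplex from `a` to `w`. -/
noncomputable def straightSimplex (a w : ℍ) : C(stdSimplex ℝ (Fin 2), ℍ) where
  toFun t := ⟨(t 0 : ℂ) * a + (t 1 : ℂ) * w, by
    have h0 := stdSimplex.zero_le t 0
    have h1 := stdSimplex.zero_le t 1
    have h2 : t 0 + t 1 = 1 := stdSimplex.add_eq_one t
    have ha : 0 < (a : ℂ).im := a.im_pos
    have hw : 0 < (w : ℂ).im := w.im_pos
    simp only [Complex.add_im, Complex.im_ofReal_mul]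
    rcases h0.eq_or_lt with h | h
    · rw [← h] at h2 ⊢
      nlinarith
    · nlinarith [mul_pos h ha, mul_nonneg h1 hw.le]⟩
  continuous_toFun := by
    rw [UpperHalfPlane.isEmbedding_coe.continuous_iff]
    have : ∀ i : Fin 2, Continuous fun t : stdSimplex ℝ (Fin 2) => t i := fun i =>
      (continuous_apply i).comp continuous_subtype_val
    exact ((Complex.continuous_ofReal.comp (this 0)).mul continuous_const).add
      ((Complex.continuous_ofReal.comp (this 1)).mul continuous_const)

/-- The underlying complex number of a point of the cone over a path. -/
noncomputable def conePoint (a : ℍ) {z w : ℍ} (c : Path z w) (t : Fin 3 → ℝ) : ℂ :=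
  (t 0 : ℂ) * a + ((t 1 + t 2 : ℝ) : ℂ) * c (Set.projIcc 0 1 zero_le_one (t 2 / (t 1 + t 2)))

theorem continuous_conePoint (a : ℍ) {z w : ℍ} (c : Path z w) : Continuous (conePoint a c) := by
  have hg : Continuous fun r : ℝ => ((c (Set.projIcc 0 1 zero_le_one r) : ℍ) : ℂ) :=
    UpperHalfPlane.continuous_coe.comp (c.continuous.comp continuous_projIcc)
  have hb : Bornology.IsBounded (Set.range fun r : unitInterval => ((c r : ℍ) : ℂ)) :=
    (isCompact_range (UpperHalfPlane.continuous_coe.comp c.continuous)).isBounded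
  obtain ⟨C, hC⟩ := hb.exists_norm_le
  rw [continuous_iff_continuousAt]
  intro t
  unfold conePoint
  have hcoord : ∀ i : Fin 3, Continuous fun t : Fin 3 → ℝ => t i := fun i => continuous_apply i
  have hsum : Continuous fun t : Fin 3 → ℝ => t 1 + t 2 := (hcoord 1).add (hcoord 2)
  refine ((Complex.continuous_ofReal.comp (hcoord 0)).mul continuous_const).continuousAt.add ?_
  -- At the apex the quotient is discontinuous, but the path is bounded and multiplied by a factor
  -- tending to 0.
  by_cases ht : t 1 + t 2 = 0
  · have hz : Filter.Tendsto (fun t : Fin 3 → ℝ => ((t 1 + t 2 : ℝ) : ℂ)) (𝓝 t) (𝓝 0) := by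
      have := (Complex.continuous_ofReal.comp hsum).continuousAt (x := t)
      rw [ContinuousAt, Function.comp_apply, ht, Complex.ofReal_zero] at this
      exact this
    rw [ContinuousAt, ht, Complex.ofReal_zero, zero_mul]
    refine hz.zero_mul_isBoundedUnder_le ⟨C, ?_⟩
    rw [Filter.eventually_map]
    exact Filter.Eventually.of_forall fun t' => hC _ ⟨_, rfl⟩
  · exact (Complex.continuous_ofReal.comp hsum).continuousAt.mul (hg.continuousAt.comp
      ((hcoord 2).continuousAt.div hsum.continuousAt ht))

/-- The cone over a path with apex `a`. -/
noncomputable def coneSimplex (a : ℍ) {z w : ℍ} (c : Path z w) : C(stdSimplex ℝ (Fin 3), ℍ) where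
  toFun t := ⟨conePoint a c t, by
    have h0 := stdSimplex.zero_le t 0
    have h1 := stdSimplex.zero_le t 1
    have h2 := stdSimplex.zero_le t 2
    have h3 : t 0 + t 1 + t 2 = 1 := by
      rw [← Fin.sum_univ_three]; exact stdSimplex.sum_eq_one t
    have ha : 0 < (a : ℂ).im := a.im_pos
    simp only [conePoint, Complex.add_im, Complex.im_ofReal_mul]
    generalize c _ = u
    have hu : 0 < (u : ℂ).im := u.im_pos
    rcases h0.eq_or_lt with h | h
    · rw [← h] at h3 ⊢
      have : t 1 + t 2 = 1 := by linarith
      rw [this]; linarith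
    · have := mul_pos h ha
      have := mul_nonneg (add_nonneg h1 h2) hu.le
      linarith⟩
  continuous_toFun := by
    rw [UpperHalfPlane.isEmbedding_coe.continuous_iff]
    exact (continuous_conePoint a c).comp continuous_subtype_val

theorem map_succAbove_apply (t : stdSimplex ℝ (Fin 2)) (i : Fin 3) (j : Fin 3) :
    stdSimplex.map i.succAbove t j = (if i.succAbove 0 = j then t 0 else 0) +
      (if i.succAbove 1 = j then t 1 else 0) := by
  rw [stdSimplex.map_coe, FunOnFinite.linearMap_apply_apply, Finset.sum_filter, Fin.sum_univ_two]

theorem conePoint_map (a : ℍ) {z w : ℍ} (c : Path z w) (t : stdSimplex ℝ (Fin 2)) (i : Fin 3)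
    {x₀ x₁ x₂ : ℝ} (h₀ : stdSimplex.map i.succAbove t 0 = x₀)
    (h₁ : stdSimplex.map i.succAbove t 1 = x₁) (h₂ : stdSimplex.map i.succAbove t 2 = x₂) :
    (simplexFace (coneSimplex a c) i t : ℂ) =
      (x₀ : ℂ) * a + ((x₁ + x₂ : ℝ) : ℂ) * c (Set.projIcc 0 1 zero_le_one (x₂ / (x₁ + x₂))) := by
  subst h₀ h₁ h₂
  rfl

theorem coneSimplex_face_zero (a : ℍ) {z w : ℍ} (c : Path z w) :
    simplexFace (coneSimplex a c) 0 = pathSimplex c := by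
  ext t
  have h2 : t 0 + t 1 = 1 := stdSimplex.add_eq_one t
  rw [conePoint_map a c t 0 (x₀ := 0) (x₁ := t 0) (x₂ := t 1)
    (by rw [map_succAbove_apply, if_neg (by decide), if_neg (by decide), add_zero])
    (by rw [map_succAbove_apply, if_pos (by decide), if_neg (by decide), add_zero])
    (by rw [map_succAbove_apply, if_neg (by decide), if_pos (by decide), zero_add]), h2]
  simp only [Complex.ofReal_zero, zero_mul, zero_add, div_one, Complex.ofReal_one, one_mul]
  rw [Set.projIcc_of_mem zero_le_one ⟨stdSimplex.zero_le t 1, stdSimplex.le_one t 1⟩]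
  rfl

theorem coneSimplex_face_one (a : ℍ) {z w : ℍ} (c : Path z w) :
    simplexFace (coneSimplex a c) 1 = straightSimplex a w := by
  ext t
  rw [conePoint_map a c t 1 (x₀ := t 0) (x₁ := 0) (x₂ := t 1)
    (by rw [map_succAbove_apply, if_pos (by decide), if_neg (by decide), add_zero])
    (by rw [map_succAbove_apply, if_neg (by decide), if_neg (by decide), add_zero])
    (by rw [map_succAbove_apply, if_neg (by decide), if_pos (by decide), zero_add]), zero_add]
  show _ = (t 0 : ℂ) * a + (t 1 : ℂ) * w
  by_cases h : t 1 = 0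
  · simp [h]
  · rw [div_self h, Set.projIcc_right]
    simp

theorem coneSimplex_face_two (a : ℍ) {z w : ℍ} (c : Path z w) :
    simplexFace (coneSimplex a c) 2 = straightSimplex a z := by
  ext t
  rw [conePoint_map a c t 2 (x₀ := t 0) (x₁ := t 1) (x₂ := 0)
    (by rw [map_succAbove_apply, if_pos (by decide), if_neg (by decide), add_zero])
    (by rw [map_succAbove_apply, if_neg (by decide), if_pos (by decide), zero_add])
    (by rw [map_succAbove_apply, if_neg (by decide), if_neg (by decide), add_zero]), add_zero, zero_div,
    Set.projIcc_left]
  show _ = (t 0 : ℂ) * a + (t 1 : ℂ) * z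
  simp

end Cone

/-! ### Homology of the quotient and homomorphisms of the group -/

section QuotientHomology

variable {Γ : Subgroup PSL(2, ℝ)}

/-- The projection `ℍ → Γ \ ℍ`. -/
noncomputable def quotProj (Γ : Subgroup PSL(2, ℝ)) : C(ℍ, QuotSpace Γ) :=
  ⟨Quotient.mk _, continuous_quotient_mk'⟩

theorem quotProj_smul (γ : Γ) (z : ℍ) : quotProj Γ (γ • z) = quotProj Γ z :=
  Quotient.sound (⟨γ, rfl⟩ : MulAction.orbitRel Γ ℍ (γ • z) z)

theorem exists_smul_of_quotProj_eq {z w : ℍ} (h : quotProj Γ z = quotProj Γ w) :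
    ∃ γ : Γ, γ • w = z := by
  obtain ⟨γ, hγ⟩ : MulAction.orbitRel Γ ℍ z w := Quotient.exact h
  exact ⟨γ, hγ⟩

theorem map_quotProj_nhds (z : ℍ) : Filter.map (quotProj Γ) (𝓝 z) = 𝓝 (quotProj Γ z) :=
  (isOpenMap_quotient_mk'_mul (Γ := Γ) (T := ℍ)).map_nhds_eq (quotProj Γ).continuous.continuousAt

/-- The class modulo boundaries of the image of a straight simplex. -/
noncomputable def straightClass (Γ : Subgroup PSL(2, ℝ)) (a w : ℍ) :
    (realChains (QuotSpace Γ)).opcycles 1 :=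
  simplexClass ((quotProj Γ).comp (straightSimplex a w))

/-- The boundary of the cone over `c` with apex `a` consists of `c` and two straight segments that
depend only on its endpoints. -/
theorem simplexClass_path (a : ℍ) {z w : ℍ} (c : Path z w) :
    simplexClass ((quotProj Γ).comp (pathSimplex c)) =
      straightClass Γ a w - straightClass Γ a z := by
  have e := simplexClass_boundary ((quotProj Γ).comp (coneSimplex a c))
  have hf : ∀ i, simplexFace ((quotProj Γ).comp (coneSimplex a c)) i =
      (quotProj Γ).comp (simplexFace (coneSimplex a c) i) := fun i => rfl
  rw [hf, hf, hf, coneSimplex_face_zero, coneSimplex_face_one, coneSimplex_face_two] at e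
  rw [← sub_eq_zero, ← e]
  unfold straightClass
  abel

theorem homologyι_sideClass (a : ℍ) (σ : Γ) (z : ℍ) (c : Path z (σ • z)) :
    ((realChains (QuotSpace Γ)).homologyι 1).hom (sideClass σ z c) =
      straightClass Γ a (σ • z) - straightClass Γ a z := by
  rw [← simplexClass_path a c]
  exact homologyι_loopClass _

/-- Both sides are the class of the image of one path, since a path and its translate by `σ` agree
in the quotient. -/
theorem straightClass_smul_sub (a : ℍ) (σ : Γ) (z w : ℍ) :
    straightClass Γ a (σ • w) - straightClass Γ a (σ • z) =
      straightClass Γ a w - straightClass Γ a z := by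
  let c : Path z w := (PathConnectedSpace.joined z w).somePath
  rw [← simplexClass_path a c, ← simplexClass_path a (c.map (continuous_const_smul σ))]
  congr 1
  ext t
  exact quotProj_smul σ _

/-- The classes `{z, σ z}` depend only on `σ`, and they define a homomorphism. -/
theorem exists_sideClass_hom (Γ : Subgroup PSL(2, ℝ)) :
    ∃ ψ : Γ → RealH1 (QuotSpace Γ), (∀ σ τ, ψ (σ * τ) = ψ σ + ψ τ) ∧
      ∀ σ z (c : Path z (σ • z)), sideClass σ z c = ψ σ := by
  let a : ℍ := UpperHalfPlane.I
  let ψ : Γ → RealH1 (QuotSpace Γ) := fun σ =>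
    sideClass σ a (PathConnectedSpace.joined a (σ • a)).somePath
  have hψ : ∀ σ z, ((realChains (QuotSpace Γ)).homologyι 1).hom (ψ σ) =
      straightClass Γ a (σ • z) - straightClass Γ a z := by
    intro σ z
    rw [homologyι_sideClass a]
    have := straightClass_smul_sub a σ z a
    rw [sub_eq_sub_iff_add_eq_add] at this ⊢
    rw [this]; abel
  refine ⟨ψ, fun σ τ => homologyι_injective ?_, fun σ z c => homologyι_injective ?_⟩
  · rw [map_add, hψ _ a, hψ σ (τ • a), hψ τ a, mul_smul]
    abel
  · rw [hψ σ z, homologyι_sideClass a]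

variable {F : Set ℍ}

namespace IsFundamentalPolygon

variable (h : IsFundamentalPolygon Γ F)
include h

/-- The powers of `γ` permute the finitely many tiles at `z`, so `γ` has finite order, and `ℝ` is
torsion-free. -/
theorem hom_eq_zero_of_smul_eq (χ : Γ → ℝ) (hχ : ∀ γ γ', χ (γ * γ') = χ γ + χ γ') {γ : Γ} {z : ℍ}
    (hγ : γ • z = z) : χ γ = 0 := by
  obtain ⟨δ, hδ⟩ := h.exists_mem_tile z
  have hmem : ∀ n : ℕ, γ ^ n * δ ∈ h.tilesAt z := by
    intro n
    rw [mem_tilesAt]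
    induction n with
    | zero => simpa using hδ
    | succ n ih =>
      rw [pow_succ', mul_assoc, ← hγ, smul_mem_tile]
      exact ih
  have hpow : ∀ n : ℕ, χ (γ ^ n) = n * χ γ := by
    intro n
    induction n with
    | zero => simpa using hχ 1 1
    | succ n ih => rw [pow_succ, hχ, ih]; push_cast; ring
  obtain ⟨m, n, hmn, e⟩ := Finite.exists_ne_map_eq_of_infinite
    (fun n : ℕ => (⟨γ ^ n * δ, hmem n⟩ : h.tilesAt z))
  have e : γ ^ m = γ ^ n := mul_right_cancel (Subtype.ext_iff.1 e)
  have e' := hpow m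
  rw [e, hpow n] at e'
  have : ((n : ℝ) - m) * χ γ = 0 := by linarith
  refine (mul_eq_zero.1 this).resolve_left ?_
  rw [sub_eq_zero]
  exact_mod_cast hmn.symm

theorem eventually_smul_eq (z : ℍ) :
    ∀ᶠ q : ℍ × ℍ in 𝓝 (z, z), ∀ γ : Γ, γ • q.1 = q.2 → γ • z = z := by
  -- An element carrying a point near `z` to a point near `z` carries some tile at `z` to a tile at
  -- `z`; only finitely many elements do so.
  have hfin : ((fun q : Γ × Γ => q.1 * q.2⁻¹) '' ((h.tilesAt z : Set Γ) ×ˢ (h.tilesAt z))).Finite :=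
    ((h.tilesAt z).finite_toSet.prod (h.tilesAt z).finite_toSet).image _
  have hev : ∀ᶠ q : ℍ × ℍ in 𝓝 (z, z),
      ∀ γ ∈ (fun q : Γ × Γ => q.1 * q.2⁻¹) '' ((h.tilesAt z : Set Γ) ×ˢ (h.tilesAt z)),
      γ • q.1 = q.2 → γ • z = z := by
    rw [Filter.eventually_all_finite hfin]
    intro γ _
    by_cases hγ : γ • z = z
    · exact Filter.Eventually.of_forall fun _ _ => hγ
    · have ho : IsOpen {q : ℍ × ℍ | γ • q.1 ≠ q.2} :=
        isOpen_ne_fun ((continuous_const_smul γ).comp continuous_fst) continuous_snd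
      filter_upwards [ho.mem_nhds hγ] with q hq hq'
      exact absurd hq' hq
  filter_upwards [hev, (continuous_fst.tendsto (z, z)).eventually (h.eventually_tiles z),
    (continuous_snd.tendsto (z, z)).eventually (h.eventually_tiles z)] with q hq h₁ h₂ γ hγ
  refine hq γ ?_ hγ
  obtain ⟨δ, hδ⟩ := h.exists_mem_tile q.1
  refine ⟨(γ * δ, δ), ⟨?_, ?_⟩, by simp⟩
  · exact h.mem_tilesAt.2 (h₂ _ (hγ ▸ smul_mem_tile.2 hδ))
  · exact h.mem_tilesAt.2 (h₁ _ hδ)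

/-- Every homomorphism `Γ → ℝ` is induced by a functional on `H₁(Γ \ ℍ, ℝ)`. -/
theorem exists_functional_of_hom (χ : Γ → ℝ) (hχ : ∀ γ γ', χ (γ * γ') = χ γ + χ γ') :
    ∃ Φ : RealH1 (QuotSpace Γ) →ₗ[ℝ] ℝ, ∀ σ z (c : Path z (σ • z)),
      Φ (sideClass σ z c) = χ σ := by
  classical
  let rep : QuotSpace Γ → ℍ := Quotient.out
  have hrep : ∀ x, quotProj Γ (rep x) = x := Quotient.out_eq
  choose g hg using fun z : ℍ => exists_smul_of_quotProj_eq (hrep (quotProj Γ z)).symm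
  have hz : ∀ (γ γ' : Γ) (z : ℍ), γ • z = γ' • z → χ γ = χ γ' := by
    intro γ γ' z e
    have := h.hom_eq_zero_of_smul_eq χ hχ (γ := γ'⁻¹ * γ) (z := z) (by
      rw [mul_smul, e, inv_smul_smul])
    have e' := hχ γ' (γ'⁻¹ * γ)
    rw [mul_inv_cancel_left, this, add_zero] at e'
    exact e'
  -- An equivariant function, usually discontinuous; the choice of `g` is harmless because `χ`
  -- vanishes on stabilizers.
  let η : ℍ → ℝ := fun z => χ (g z)
  have hη : ∀ (γ : Γ) (z : ℍ), η (γ • z) = η z + χ γ := by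
    intro γ z
    have := hz (g (γ • z)) (γ * g z) (rep (quotProj Γ z)) (by
      rw [mul_smul, hg z]
      conv_rhs => rw [← hg (γ • z), quotProj_smul])
    show χ _ = χ _ + χ _
    rw [this, hχ, add_comm]
  have hnear : ∀ z : ℍ, ∃ U ∈ 𝓝 z, ∀ w ∈ U, ∀ w' ∈ U, ∀ γ : Γ, γ • w = w' → γ • z = z := by
    intro z
    have := h.eventually_smul_eq z
    rw [nhds_prod_eq, Filter.eventually_prod_self_iff'] at this
    obtain ⟨U, hU, hU'⟩ := this
    exact ⟨U, hU, fun w hw w' hw' => hU' w hw w' hw'⟩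
  choose U hU hUγ using hnear
  -- Local differences of `η` descend to the quotient: two lifts of `y` in the small neighbourhood
  -- differ by a stabilizer element. The value 0 for `y` far from `x` is arbitrary.
  let k : QuotSpace Γ → QuotSpace Γ → ℝ := fun x y =>
    if H : ∃ w ∈ U (rep x), quotProj Γ w = y then η H.choose - η (rep x) else 0
  have hk : ∀ x, ∀ w ∈ U (rep x), k x (quotProj Γ w) = η w - η (rep x) := by
    intro x w hw
    have H : ∃ w' ∈ U (rep x), quotProj Γ w' = quotProj Γ w := ⟨w, hw, rfl⟩
    show (if H : ∃ w' ∈ U (rep x), quotProj Γ w' = quotProj Γ w then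
      η H.choose - η (rep x) else 0) = _
    rw [dif_pos H]
    obtain ⟨hc, hc'⟩ := H.choose_spec
    obtain ⟨γ, hγ⟩ := exists_smul_of_quotProj_eq hc'
    rw [← hγ, hη, h.hom_eq_zero_of_smul_eq χ hχ (hUγ _ w hw _ hc γ hγ), add_zero]
  have hloc : ∀ z : ℍ, ∀ᶠ w in 𝓝 z, k (quotProj Γ z) (quotProj Γ w) = η w - η z := by
    intro z
    obtain ⟨δ, hδ⟩ := exists_smul_of_quotProj_eq (hrep (quotProj Γ z)).symm
    have hδ' : δ⁻¹ • z = rep (quotProj Γ z) := by rw [← hδ, inv_smul_smul, hδ]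
    have hcont : ContinuousAt (fun w : ℍ => δ⁻¹ • w) z := (continuous_const_smul δ⁻¹).continuousAt
    have hev := hcont.eventually (show ∀ᶠ w in 𝓝 (δ⁻¹ • z), w ∈ U (rep (quotProj Γ z)) by
      rw [hδ']; exact hU _)
    filter_upwards [hev] with w hw
    have := hk _ _ hw
    rw [quotProj_smul, ← hδ', hη, hη] at this
    rw [this]; ring
  obtain ⟨Φ, hΦ⟩ := exists_functional_of_local k (by
    intro x
    obtain ⟨z, rfl⟩ : ∃ z, quotProj Γ z = x := ⟨_, hrep x⟩
    rw [← map_quotProj_nhds, Filter.eventually_map]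
    filter_upwards [hloc z, (hloc z).eventually_nhds] with w hw hw'
    rw [← map_quotProj_nhds, Filter.eventually_map]
    filter_upwards [hw', hloc w] with w' h₁ h₂
    rw [h₁, hw, h₂]; ring)
  refine ⟨Φ, fun σ z c => ?_⟩
  have := hΦ _ (projLoop σ z c) (fun t => η (c t)) fun t =>
    (c.continuous.continuousAt.eventually (hloc (c t))).mono fun t' ht' => ht'.symm
  rw [sideClass, this, c.source, c.target, hη]
  ring

end IsFundamentalPolygon

end QuotientHomology

/-! ### Vertex relations between side pairings -/

section Relations

variable {Γ : Subgroup PSL(2, ℝ)} {F : Set ℍ}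

theorem incidence_mem (p w : ℍ) (γ γ' : Γ) : incidence F p w γ γ' ∈ ({-1, 0, 1} : Set ℝ) := by
  unfold incidence
  split_ifs <;> norm_num

theorem mem_tile_of_incidence_ne_zero {p w : ℍ} {γ γ' : Γ} (hw : incidence F p w γ γ' ≠ 0) :
    w ∈ tile F γ ∧ w ∈ tile F γ' := by
  by_cases h₁ : Follows F p w γ γ'
  · exact ⟨h₁.2.1, h₁.2.2.1⟩
  by_cases h₂ : Follows F p w γ' γ
  · exact ⟨h₂.2.2.1, h₂.2.1⟩
  exact absurd (by simp [incidence, h₁, h₂]) hw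

theorem follows_of_incidence_eq_one {p w : ℍ} {γ γ' : Γ} (hw : incidence F p w γ γ' = 1) :
    Follows F p w γ γ' ∧ ¬ Follows F p w γ' γ := by
  unfold incidence at hw
  split_ifs at hw <;> first | exact ⟨‹_›, ‹_›⟩ | norm_num at hw

namespace IsFundamentalPolygon

variable (h : IsFundamentalPolygon Γ F)
include h

/-- A side has at most one initial point. -/
theorem eq_of_incidence_eq_one {p w w' : ℍ} (hp : p ∈ F) {γ γ' : Γ}
    (hw : incidence F p w γ γ' = 1) (hw' : incidence F p w' γ γ' = 1) : w = w' := by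
  by_contra hne
  obtain ⟨⟨hγ, h₁, h₂, -⟩, hn⟩ := follows_of_incidence_eq_one hw
  obtain ⟨⟨-, h₁', h₂', -⟩, hn'⟩ := follows_of_incidence_eq_one hw'
  -- Seen along the segment in one of its two directions, `γ'` is on the right; so `γ` follows `γ'`
  -- at `w` or at `w'`, which incidence 1 excludes.
  have e : orientation w w' (γ' • p) < 0 ∨ orientation w' w (γ' • p) < 0 := by
    rw [orientation_swap w w', neg_lt_zero]
    exact lt_or_gt_of_ne (h.orientation_ne_zero hγ.symm hp hne h₂ h₂' h₁ h₁')
  rcases e with e | e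
  · exact hn ⟨hγ.symm, h₂, h₁, w', h₂', h₁', e⟩
  · exact hn' ⟨hγ.symm, h₂', h₁', w, h₂, h₁, e⟩

theorem eq_of_incidence_eq_neg_one {p w w' : ℍ} (hp : p ∈ F) {γ γ' : Γ}
    (hw : incidence F p w γ γ' = -1) (hw' : incidence F p w' γ γ' = -1) : w = w' := by
  refine h.eq_of_incidence_eq_one hp (γ := γ') (γ' := γ) ?_ ?_
  · rw [incidence_swap, hw, neg_neg]
  · rw [incidence_swap, hw', neg_neg]

theorem finite_incidence {p : ℍ} (hp : p ∈ F) (σ : Γ) : {w | incidence F p w 1 σ ≠ 0}.Finite := by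
  have h₁ : {w | incidence F p w 1 σ = 1}.Subsingleton := fun w hw w' hw' =>
    h.eq_of_incidence_eq_one hp hw hw'
  have h₂ : {w | incidence F p w 1 σ = -1}.Subsingleton := fun w hw w' hw' =>
    h.eq_of_incidence_eq_neg_one hp hw hw'
  refine (h₁.finite.union h₂.finite).subset fun w hw => ?_
  rcases incidence_mem p w 1 σ with e | e | e
  · exact Or.inr e
  · exact absurd e hw
  · exact Or.inl e

-- Around `z` each point of its orbit in `F̄` is seen as often as the stabilizer of `z` has
-- elements. Dividing by this number makes elliptic points behave like ordinary ones.
open Classical in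
theorem exists_card_fiber (z : ℍ) : ∃ N : ℝ, 0 < N ∧ ∀ w ∈ closure F, quotProj Γ w = quotProj Γ z →
    (∑ γ ∈ h.tilesAt z, if γ⁻¹ • z = w then (1 : ℝ) else 0) = N := by
  classical
  obtain ⟨γ₀, hγ₀⟩ := h.exists_mem_tile z
  refine ⟨((h.tilesAt z).filter fun γ => γ⁻¹ • z = γ₀⁻¹ • z).card, ?_, fun w hw hwz => ?_⟩
  · rw [Nat.cast_pos, Finset.card_pos]
    exact ⟨γ₀, Finset.mem_filter.2 ⟨h.mem_tilesAt.2 hγ₀, rfl⟩⟩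
  · rw [Finset.sum_boole]
    congr 1
    obtain ⟨δ, hδ⟩ := exists_smul_of_quotProj_eq (hwz.trans (quotProj_smul γ₀⁻¹ z).symm)
    -- If `δ` moves the reference point to `w`, right multiplication by `δ` matches the two fibres.
    refine Finset.card_nbij' (fun γ => γ * δ) (fun γ => γ * δ⁻¹) ?_ ?_ ?_ ?_
    · intro γ hγ
      simp only [Finset.coe_filter, Set.mem_ofPred_eq, mem_tilesAt] at hγ ⊢
      have e : (γ * δ)⁻¹ • z = γ₀⁻¹ • z := by rw [mul_inv_rev, mul_smul, hγ.2, ← hδ, inv_smul_smul]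
      exact ⟨mem_tile.2 (by rw [e]; exact mem_tile.1 hγ₀), e⟩
    · intro γ hγ
      simp only [Finset.coe_filter, Set.mem_ofPred_eq, mem_tilesAt] at hγ ⊢
      have e : (γ * δ⁻¹)⁻¹ • z = w := by rw [mul_inv_rev, mul_smul, hγ.2, inv_inv, hδ]
      exact ⟨mem_tile.2 (by rwa [e]), e⟩
    · intro γ _; simp
    · intro γ _; simp

/-- The number of tiles at a point which show a given point of the orbit. -/
noncomputable def multiplicity (z : ℍ) : ℝ := (h.exists_card_fiber z).choose

/-- The relation between side pairings given by the tiles around a point. -/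
noncomputable def vertexRelation (p z : ℍ) : Γ →₀ ℝ :=
  ∑ γ ∈ h.tilesAt z, ∑ γ' ∈ h.tilesAt z,
    Finsupp.single (γ⁻¹ * γ') ((h.multiplicity z)⁻¹ * incidence F p z γ γ')

theorem linearCombination_vertexRelation (p z : ℍ) (f : Γ → ℝ) :
    Finsupp.linearCombination ℝ f (h.vertexRelation p z) = (h.multiplicity z)⁻¹ *
      ∑ γ ∈ h.tilesAt z, ∑ γ' ∈ h.tilesAt z, incidence F p z γ γ' * f (γ⁻¹ * γ') := by
  simp only [vertexRelation, map_sum, Finsupp.linearCombination_single, smul_eq_mul,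
    Finset.mul_sum, mul_assoc]

theorem vertexRelation_inv (p z : ℍ) (σ : Γ) :
    h.vertexRelation p z σ⁻¹ = -h.vertexRelation p z σ := by
  classical
  simp only [vertexRelation, Finsupp.finsetSum_apply, Finsupp.single_apply]
  rw [Finset.sum_comm, ← Finset.sum_neg_distrib]
  refine Finset.sum_congr rfl fun γ _ => ?_
  rw [← Finset.sum_neg_distrib]
  refine Finset.sum_congr rfl fun γ' _ => ?_
  have e : γ'⁻¹ * γ = σ⁻¹ ↔ γ⁻¹ * γ' = σ := by
    rw [← inv_inj, mul_inv_rev, inv_inv, inv_inv]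
  simp only [e]
  split_ifs
  · rw [incidence_swap]; ring
  · simp

-- Moving each tile `γ` at `z` back to `F̄` turns the sum around `z` into a sum over points `w` of
-- `F̄` equivalent to `z`; the multiplicity cancels.
open Classical in
theorem vertexRelation_apply {p : ℍ} (hp : p ∈ F) (z : ℍ) (σ : Γ) :
    h.vertexRelation p z σ = ∑ w ∈ (h.finite_incidence hp σ).toFinset,
      incidence F p w 1 σ * if quotProj Γ w = quotProj Γ z then 1 else 0 := by
  classical
  obtain ⟨hN, hcard⟩ := (h.exists_card_fiber z).choose_spec
  change 0 < h.multiplicity z at hN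
  have e₁ : ∀ γ ∈ h.tilesAt z, ∑ γ' ∈ h.tilesAt z, (Finsupp.single (γ⁻¹ * γ')
      ((h.multiplicity z)⁻¹ * incidence F p z γ γ') : Γ →₀ ℝ) σ =
      (h.multiplicity z)⁻¹ * incidence F p (γ⁻¹ • z) 1 σ := by
    intro γ hγ
    have e : incidence F p (γ⁻¹ • z) 1 σ = incidence F p z γ (γ * σ) := by
      rw [← incidence_smul γ, smul_inv_smul, mul_one]
    rw [Finset.sum_eq_single (γ * σ)]
    · simp [e]
    · intro γ' _ hne
      rw [Finsupp.single_apply, if_neg]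
      rintro rfl
      exact hne (by simp)
    · intro hn
      have : incidence F p z γ (γ * σ) = 0 := by
        by_contra hcon
        exact hn (h.mem_tilesAt.2 (mem_tile_of_incidence_ne_zero hcon).2)
      simp [this]
  have e₂ : ∀ γ ∈ h.tilesAt z, (h.multiplicity z)⁻¹ * incidence F p (γ⁻¹ • z) 1 σ =
      ∑ w ∈ (h.finite_incidence hp σ).toFinset, (h.multiplicity z)⁻¹ * (incidence F p w 1 σ *
        if γ⁻¹ • z = w then 1 else 0) := by
    intro γ _
    rw [← Finset.mul_sum]
    congr 1
    simp only [mul_ite, mul_one, mul_zero]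
    rw [Finset.sum_ite_eq, eq_comm, ite_eq_left_iff]
    intro hn
    by_contra hcon
    exact hn (by simpa using fun e => hcon e.symm)
  rw [vertexRelation, Finsupp.finsetSum_apply]
  simp_rw [Finsupp.finsetSum_apply]
  rw [Finset.sum_congr rfl e₁, Finset.sum_congr rfl e₂, Finset.sum_comm]
  refine Finset.sum_congr rfl fun w hw => ?_
  rw [← Finset.mul_sum, ← Finset.mul_sum]
  by_cases hwz : quotProj Γ w = quotProj Γ z
  · have hw' : w ∈ closure F := by
      have := (mem_tile_of_incidence_ne_zero ((Set.Finite.mem_toFinset _).1 hw)).1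
      rwa [mem_tile, inv_one, one_smul] at this
    rw [hcard w hw' hwz, if_pos hwz]
    change (h.multiplicity z)⁻¹ * (_ * h.multiplicity z) = _
    field_simp
  · rw [if_neg hwz, Finset.sum_eq_zero]
    · simp
    · intro γ _
      rw [if_neg]
      rintro rfl
      exact hwz (quotProj_smul _ _)

/-- The relation between side pairings with given weights at the vertices. -/
noncomputable def relation (p : ℍ) : (QuotSpace Γ →₀ ℝ) →ₗ[ℝ] (Γ →₀ ℝ) :=
  Finsupp.linearCombination ℝ fun y => h.vertexRelation p (Quotient.out y)

/-- This is the form to which rounding applies: at most one incidence number is 1 and at most one is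
-1. -/
theorem relation_apply {p : ℍ} (hp : p ∈ F) (μ : QuotSpace Γ →₀ ℝ) (σ : Γ) :
    h.relation p μ σ = ∑ w ∈ (h.finite_incidence hp σ).toFinset,
      incidence F p w 1 σ * μ (quotProj Γ w) := by
  classical
  induction μ using Finsupp.induction_linear with
  | zero => simp
  | add μ ν hμ hν => simp only [map_add, Finsupp.add_apply, hμ, hν, mul_add, Finset.sum_add_distrib]
  | single y r =>
    have hy : quotProj Γ (Quotient.out y) = y := Quotient.out_eq y
    rw [relation, Finsupp.linearCombination_single, Finsupp.smul_apply,
      h.vertexRelation_apply hp, Finset.smul_sum]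
    refine Finset.sum_congr rfl fun w _ => ?_
    rw [hy, Finsupp.single_apply, smul_eq_mul]
    simp only [eq_comm (a := y)]
    split_ifs <;> ring

theorem relation_inv (p : ℍ) (μ : QuotSpace Γ →₀ ℝ) (σ : Γ) :
    h.relation p μ σ⁻¹ = -h.relation p μ σ := by
  induction μ using Finsupp.induction_linear with
  | zero => simp
  | add μ ν hμ hν => simp only [map_add, Finsupp.add_apply, hμ, hν, neg_add]
  | single y r =>
    rw [relation, Finsupp.linearCombination_single, Finsupp.smul_apply, Finsupp.smul_apply,
      vertexRelation_inv, smul_neg]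

theorem linearCombination_relation {p : ℍ} (hp : p ∈ F) (μ : QuotSpace Γ →₀ ℝ) (χ : Γ → ℝ)
    (hχ : ∀ γ γ', χ (γ * γ') = χ γ + χ γ') :
    Finsupp.linearCombination ℝ χ (h.relation p μ) = 0 := by
  induction μ using Finsupp.induction_linear with
  | zero => simp
  | add μ ν hμ hν => simp only [map_add, hμ, hν, add_zero]
  | single y r =>
    rw [relation, Finsupp.linearCombination_single, map_smul, linearCombination_vertexRelation,
      h.sum_incidence_hom hp _ χ hχ, mul_zero, smul_zero]

theorem sum_incidence_smul (p z : ℍ) (δ : Γ) (f : Γ → ℝ) :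
    ∑ γ ∈ h.tilesAt (δ • z), ∑ γ' ∈ h.tilesAt (δ • z), incidence F p (δ • z) γ γ' * f (γ⁻¹ * γ') =
      ∑ γ ∈ h.tilesAt z, ∑ γ' ∈ h.tilesAt z, incidence F p z γ γ' * f (γ⁻¹ * γ') := by
  have e : h.tilesAt (δ • z) = (h.tilesAt z).map (mulLeftEmbedding δ) := by
    ext γ
    rw [mem_tilesAt, Finset.mem_map]
    constructor
    · intro hγ
      refine ⟨δ⁻¹ * γ, ?_, by simp⟩
      rw [mem_tilesAt, ← smul_mem_tile (δ := δ), mul_inv_cancel_left]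
      exact hγ
    · rintro ⟨γ', hγ', rfl⟩
      exact smul_mem_tile.2 (h.mem_tilesAt.1 hγ')
  rw [e, Finset.sum_map]
  refine Finset.sum_congr rfl fun γ _ => ?_
  rw [Finset.sum_map]
  refine Finset.sum_congr rfl fun γ' _ => ?_
  simp only [mulLeftEmbedding_apply, incidence_smul, mul_inv_rev, mul_assoc, inv_mul_cancel_left]

/-- A combination of side pairings which is killed by all homomorphisms `Γ → ℝ` is, up to
antisymmetrization, a combination of vertex relations. -/
theorem exists_relation_eq {p : ℍ} (hp : p ∈ F) (x : Γ →₀ ℝ)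
    (hx : ∀ σ ∈ x.support, Adjacent F 1 σ)
    (hχ : ∀ χ : Γ → ℝ, (∀ γ γ', χ (γ * γ') = χ γ + χ γ') → Finsupp.linearCombination ℝ χ x = 0) :
    ∃ μ, h.relation p μ = x - x.mapDomain (fun σ => σ⁻¹) := by
  by_contra hcon
  -- Otherwise a functional kills all vertex relations but not this vector. Its odd part on group
  -- elements extends to a homomorphism `χ`, and its value on the vector is the value of `χ` on `x`,
  -- which is 0.
  obtain ⟨L, hL, hLk⟩ := Submodule.exists_le_ker_of_notMem
    (p := LinearMap.range (h.relation p)) (v := x - x.mapDomain (fun σ => σ⁻¹))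
    (fun ⟨μ, hμ⟩ => hcon ⟨μ, hμ⟩)
  let f : Γ → ℝ := fun σ => L (Finsupp.single σ 1)
  have hf : ∀ v, L v = Finsupp.linearCombination ℝ f v := by
    intro v
    have : L = Finsupp.linearCombination ℝ f := by
      ext σ
      simp [f]
    rw [this]
  have hsum₀ : ∀ z, ∑ γ ∈ h.tilesAt z, ∑ γ' ∈ h.tilesAt z,
      incidence F p z γ γ' * f (γ⁻¹ * γ') = 0 := by
    intro z
    obtain ⟨δ, hδ⟩ := exists_smul_of_quotProj_eq
      (show quotProj Γ z = quotProj Γ (Quotient.out (quotProj Γ z)) from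
        (Quotient.out_eq (quotProj Γ z)).symm)
    have hk : L (h.relation p (Finsupp.single (quotProj Γ z) 1)) = 0 := hLk ⟨_, rfl⟩
    rw [relation, Finsupp.linearCombination_single, one_smul, hf,
      linearCombination_vertexRelation, mul_eq_zero] at hk
    rw [← hδ, sum_incidence_smul]
    refine hk.resolve_left (inv_ne_zero ?_)
    exact (h.exists_card_fiber _).choose_spec.1.ne'
  obtain ⟨χ, hhom, hχf⟩ := h.exists_hom hp (fun σ => f σ - f σ⁻¹) (fun σ => by
    rw [inv_inv]; ring) (fun z => by
    have e : ∑ γ ∈ h.tilesAt z, ∑ γ' ∈ h.tilesAt z,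
        incidence F p z γ γ' * f (γ⁻¹ * γ')⁻¹ = 0 := by
      rw [← neg_eq_zero, ← hsum₀ z, Finset.sum_comm, ← Finset.sum_neg_distrib]
      refine Finset.sum_congr rfl fun γ _ => ?_
      rw [← Finset.sum_neg_distrib]
      refine Finset.sum_congr rfl fun γ' _ => ?_
      rw [incidence_swap, mul_inv_rev, inv_inv, neg_mul, neg_neg]
    simp only [mul_sub, Finset.sum_sub_distrib]
    rw [hsum₀, e, sub_zero])
  apply hL
  rw [map_sub, hf, hf, Finsupp.linearCombination_mapDomain]
  have e : Finsupp.linearCombination ℝ f x - Finsupp.linearCombination ℝ (f ∘ fun σ => σ⁻¹) x =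
      Finsupp.linearCombination ℝ χ x := by
    simp only [Finsupp.linearCombination_apply, Finsupp.sum]
    rw [← Finset.sum_sub_distrib]
    refine Finset.sum_congr rfl fun σ hσ => ?_
    rw [hχf σ (hx σ hσ), ← smul_sub]
    rfl
  rw [e, hχ χ hhom]

end IsFundamentalPolygon

/-- If `L` and `σ⁻¹ L` both lie in `F̄`, then `L` lies in `F̄ ∩ σ F̄`. -/
theorem adjacent_of_mem_sidePairings {σ : Γ} (hσ : σ ∈ sidePairings Γ F) : Adjacent F 1 σ := by
  obtain ⟨hne, L, ⟨hL, γ, -, hLγ⟩, -, γ', -, hLγ'⟩ := hσ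
  refine ⟨fun e => hne e.symm, hL.mono fun z hz => ⟨?_, ?_⟩⟩
  · rw [mem_tile, inv_one, one_smul]
    rw [hLγ] at hz
    exact hz.2
  · rw [mem_tile]
    have : σ⁻¹ • z ∈ σ⁻¹ • L := Set.smul_mem_smul_set hz
    rw [hLγ'] at this
    exact this.2

end Relations

/-! ### Rounding relations and reading off coordinates -/

section Coordinates

variable {Γ : Subgroup PSL(2, ℝ)} {F : Set ℍ}

theorem hom_inv {χ : Γ → ℝ} (hχ : ∀ γ γ', χ (γ * γ') = χ γ + χ γ') (γ : Γ) : χ γ⁻¹ = -χ γ := by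
  have h₁ := hχ 1 1
  have h₂ := hχ γ γ⁻¹
  rw [mul_one] at h₁
  rw [mul_inv_cancel] at h₂
  linarith

theorem sub_mapDomain_inv_apply (x : Γ →₀ ℝ) (σ : Γ) :
    (x - x.mapDomain (fun σ => σ⁻¹)) σ = x σ - x σ⁻¹ := by
  rw [Finsupp.sub_apply]
  congr 1
  simpa using Finsupp.mapDomain_apply inv_injective x σ⁻¹

namespace IsFundamentalPolygon

variable (h : IsFundamentalPolygon Γ F)
include h

/-- The coefficients of a relation between side pairings can be rounded to `-1`, `0`, `1`. -/
theorem exists_relation_of_killed (x : Γ →₀ ℝ) (hx : ∀ σ ∈ x.support, Adjacent F 1 σ)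
    (hχ : ∀ χ : Γ → ℝ, (∀ γ γ', χ (γ * γ') = χ γ + χ γ') → Finsupp.linearCombination ℝ χ x = 0)
    {σ₀ : Γ} (h₀ : x σ₀ - x σ₀⁻¹ = 1) :
    ∃ y : Γ →₀ ℝ, y σ₀ = 1 ∧ (∀ σ, y σ ∈ ({-1, 0, 1} : Set ℝ)) ∧ (∀ σ, y σ⁻¹ = -y σ) ∧
      (∀ σ, x σ = 0 → x σ⁻¹ = 0 → y σ = 0) ∧
      ∀ χ : Γ → ℝ, (∀ γ γ', χ (γ * γ') = χ γ + χ γ') → Finsupp.linearCombination ℝ χ y = 0 := by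
  obtain ⟨p, hp⟩ := h.isConnected.nonempty
  obtain ⟨μ, hμ⟩ := h.exists_relation_eq hp x hx hχ
  have hex : ∀ σ, ∃ u v : ℝ, ∀ φ : ℝ → ℝ, φ 0 = 0 →
      ∑ w ∈ (h.finite_incidence hp σ).toFinset,
        incidence F p w 1 σ * φ (μ (quotProj Γ w)) = φ u - φ v := fun σ =>
    exists_sum_eq_sub _ _ (fun w _ => incidence_mem p w 1 σ)
      (fun _ _ _ _ => h.eq_of_incidence_eq_one hp)
      (fun _ _ _ _ => h.eq_of_incidence_eq_neg_one hp) _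
  choose u v huv using hex
  have hsub : ∀ σ, x σ - x σ⁻¹ = u σ - v σ := fun σ => by
    rw [← sub_mapDomain_inv_apply, ← hμ, h.relation_apply hp]
    exact huv σ id rfl
  -- Rounding the weights with a jump at `u σ₀` turns each coefficient `u σ - v σ` into a difference
  -- of step values: 0 stays 0, and the coefficient 1 of `σ₀` stays 1.
  have hy : ∀ σ, h.relation p (μ.mapRange (step (u σ₀)) (step_zero _)) σ =
      step (u σ₀) (u σ) - step (u σ₀) (v σ) := fun σ => by
    rw [h.relation_apply hp]
    exact huv σ _ (step_zero _)
  refine ⟨h.relation p (μ.mapRange (step (u σ₀)) (step_zero _)), ?_, fun σ => ?_,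
    h.relation_inv p _, fun σ h₁ h₂ => ?_, fun χ hχ' => h.linearCombination_relation hp _ χ hχ'⟩
  · rw [hy]
    exact step_sub_of_sub_eq_one ((hsub σ₀).symm.trans h₀)
  · rw [hy]
    exact step_sub_mem _ _ _
  · have e := hsub σ
    rw [h₁, h₂, sub_zero, eq_comm, sub_eq_zero] at e
    rw [hy, e, sub_self]

/-- The expansion of `ψ σ` in the basis is a relation among side pairings. Its rounded form involves
no new elements, and applying the `i`-th coordinate to it leaves only `σ`, `s i` and their inverses.
-/
theorem repr_hom_mem (ψ : Γ → RealH1 (QuotSpace Γ)) (hψ : ∀ σ τ, ψ (σ * τ) = ψ σ + ψ τ)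
    (hΦ : ∀ χ : Γ → ℝ, (∀ γ γ', χ (γ * γ') = χ γ + χ γ') →
      ∃ Φ : RealH1 (QuotSpace Γ) →ₗ[ℝ] ℝ, ∀ σ, Φ (ψ σ) = χ σ)
    {ι : Type*} (B : Module.Basis ι ℝ (RealH1 (QuotSpace Γ))) (s : ι → Γ)
    (hs : ∀ i, Adjacent F 1 (s i)) (hB : ∀ i, B i = ψ (s i)) {σ : Γ} (hσ : Adjacent F 1 σ)
    (i : ι) : B.repr (ψ σ) i ∈ ({-1, 0, 1} : Set ℝ) := by
  classical
  have hχ : ∀ γ γ', B.repr (ψ (γ * γ')) i = B.repr (ψ γ) i + B.repr (ψ γ') i := fun γ γ' => by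
    rw [hψ, map_add, Finsupp.add_apply]
  obtain ⟨χ, hχdef⟩ : ∃ χ : Γ → ℝ, χ = fun γ => B.repr (ψ γ) i := ⟨_, rfl⟩
  replace hχ : ∀ γ γ', χ (γ * γ') = χ γ + χ γ' := by rw [hχdef]; exact hχ
  have hinv := hom_inv hχ
  have hχs : ∀ j, χ (s j) = if j = i then 1 else 0 := fun j => by
    rw [hχdef, ← Finsupp.single_apply, ← B.repr_self, hB]
  have hχσ : B.repr (ψ σ) i = χ σ := by rw [hχdef]
  rw [hχσ]
  -- Involutions and basis elements or their inverses are treated directly; in the remaining case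
  -- `σ` has antisymmetrized coefficient exactly 1.
  by_cases h₁ : σ⁻¹ = σ
  · have := hinv σ
    rw [h₁] at this
    exact Or.inr (Or.inl (by linarith))
  by_cases h₂ : ∃ j, s j = σ
  · obtain ⟨j, rfl⟩ := h₂
    rw [hχs]
    split_ifs <;> simp
  by_cases h₃ : ∃ j, s j = σ⁻¹
  · obtain ⟨j, hj⟩ := h₃
    have := hinv σ
    rw [← hj, hχs] at this
    rw [← neg_neg (χ σ), ← this]
    split_ifs <;> simp
  have hsinj : Function.Injective s := fun j k e => B.injective (by rw [hB, hB, e])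
  obtain ⟨x, hx⟩ : ∃ x : Γ →₀ ℝ, x = Finsupp.single σ 1 - (B.repr (ψ σ)).mapDomain s := ⟨_, rfl⟩
  have hx₀ : ∀ τ, τ ≠ σ → (∀ j, s j ≠ τ) → x τ = 0 := fun τ h₄ h₅ => by
    rw [hx, Finsupp.sub_apply, Finsupp.single_eq_of_ne h₄,
      Finsupp.mapDomain_of_notMem_range _ _ (fun ⟨j, hj⟩ => h₅ j hj), sub_zero]
  have hxσ : x σ = 1 := by
    rw [hx, Finsupp.sub_apply, Finsupp.single_eq_same,
      Finsupp.mapDomain_of_notMem_range _ _ (fun ⟨j, hj⟩ => h₂ ⟨j, hj⟩), sub_zero]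
  obtain ⟨y, hyσ, hymem, hyinv, hy₀, hykill⟩ := h.exists_relation_of_killed x
    (fun τ hτ => by
      by_contra hcon
      refine Finsupp.mem_support_iff.1 hτ (hx₀ τ ?_ ?_)
      · rintro rfl; exact hcon hσ
      · rintro j rfl; exact hcon (hs j))
    (fun χ' hχ' => by
      obtain ⟨Φ, hΦ'⟩ := hΦ χ' hχ'
      have e : Finsupp.linearCombination ℝ (χ' ∘ s) (B.repr (ψ σ)) = χ' σ := by
        have : χ' ∘ s = Φ ∘ B := by
          funext j
          rw [Function.comp_apply, Function.comp_apply, hB, hΦ']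
        rw [this, ← Finsupp.apply_linearCombination, B.linearCombination_repr, hΦ']
      rw [hx, map_sub, Finsupp.linearCombination_mapDomain, e, Finsupp.linearCombination_single,
        one_smul, sub_self])
    (σ₀ := σ) (by rw [hxσ, hx₀ σ⁻¹ h₁ fun j hj => h₃ ⟨j, hj⟩, sub_zero])
  have hterm : ∀ τ, τ ∉ ({σ, σ⁻¹, s i, (s i)⁻¹} : Finset Γ) → y τ * χ τ = 0 := by
    intro τ hτ
    simp only [Finset.mem_insert, Finset.mem_singleton, not_or] at hτ
    by_cases h₄ : ∃ j, s j = τ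
    · obtain ⟨j, rfl⟩ := h₄
      rw [hχs, if_neg (by rintro rfl; exact hτ.2.2.1 rfl), mul_zero]
    by_cases h₅ : ∃ j, s j = τ⁻¹
    · obtain ⟨j, hj⟩ := h₅
      have := hχs j
      rw [hj, hinv, if_neg (by rintro rfl; exact hτ.2.2.2 (by rw [hj, inv_inv])),
        neg_eq_zero] at this
      rw [this, mul_zero]
    · rw [hy₀ τ (hx₀ τ hτ.1 fun j hj => h₄ ⟨j, hj⟩)
        (hx₀ _ (fun e => hτ.2.1 (by rw [← e, inv_inv])) fun j hj => h₅ ⟨j, hj⟩), zero_mul]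
  have hsum : ∑ τ ∈ ({σ, σ⁻¹, s i, (s i)⁻¹} : Finset Γ), y τ * χ τ = 0 := by
    rw [← hykill χ hχ, Finsupp.linearCombination_apply,
      Finsupp.sum_of_support_subset y (s := y.support ∪ {σ, σ⁻¹, s i, (s i)⁻¹})
        Finset.subset_union_left _ (fun τ _ => by rw [zero_smul])]
    exact Finset.sum_subset Finset.subset_union_right fun τ _ hτ => hterm τ hτ
  have hsi : s i ≠ (s i)⁻¹ := fun e => by
    have h₄ := hinv (s i)
    rw [← e, hχs, if_pos rfl] at h₄
    norm_num at h₄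
  rw [Finset.sum_insert, Finset.sum_insert, Finset.sum_insert, Finset.sum_singleton, hyinv, hyinv,
    hinv, hinv, hyσ, hχs, if_pos rfl] at hsum
  -- Both `y` and `χ` are odd, so inverses double each term and the sum reads `2 χ σ + 2 y (s i) =
  -- 0`.
  · have e : χ σ = -y (s i) := by linarith
    rw [e, ← hyinv]
    exact hymem _
  · simpa using hsi
  · simp only [Finset.mem_insert, Finset.mem_singleton, not_or, inv_inj]
    exact ⟨fun e => h₃ ⟨i, e.symm⟩, fun e => h₂ ⟨i, e.symm⟩⟩
  · simp only [Finset.mem_insert, Finset.mem_singleton, not_or]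
    exact ⟨fun e => h₁ e.symm, fun e => h₂ ⟨i, e.symm⟩,
      fun e => h₃ ⟨i, by rw [e, inv_inv]⟩⟩

/-- The coordinates of the class of a side pairing in a basis of classes of side pairings. -/
theorem repr_sideClass_mem {ι : Type*} (B : Module.Basis ι ℝ (RealH1 (QuotSpace Γ)))
    (hB : ∀ i, ∃ σ ∈ sidePairings Γ F, ∃ (z : ℍ) (c : Path z (σ • z)), B i = sideClass σ z c)
    {σ : Γ} (hσ : σ ∈ sidePairings Γ F) (z : ℍ) (c : Path z (σ • z)) (i : ι) :
    B.repr (sideClass σ z c) i ∈ ({-1, 0, 1} : Set ℝ) := by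
  obtain ⟨ψ, hψ, hψc⟩ := exists_sideClass_hom Γ
  choose s hs z' c' hs' using hB
  rw [hψc]
  refine h.repr_hom_mem ψ hψ (fun χ hχ => ?_) B s (fun j => adjacent_of_mem_sidePairings (hs j))
    (fun j => (hs' j).trans (hψc _ _ _)) (adjacent_of_mem_sidePairings hσ) i
  obtain ⟨Φ, hΦ⟩ := h.exists_functional_of_hom χ hχ
  refine ⟨Φ, fun τ => ?_⟩
  rw [← hψc τ z (PathConnectedSpace.joined z (τ • z)).somePath, hΦ]

end IsFundamentalPolygon

/-- Pairing with a dual basis element agrees with the coordinate functional on the basis, hence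
everywhere. -/
theorem capPairing_eq_repr {X : Type} [TopologicalSpace X] {ι : Type*}
    (B : Module.Basis ι ℝ (RealH1 X)) (ω : RealCoh1 X) (i : ι) (hi : capPairing X (B i) ω = 1)
    (hne : ∀ j, j ≠ i → capPairing X (B j) ω = 0) (v : RealH1 X) :
    capPairing X v ω = B.repr v i := by
  let f : RealH1 X →ₗ[ℝ] ℝ :=
    (Submodule.liftQ _ (cocyclePairing X) (cocyclePairing_coboundary X) ω).hom
  have : f = B.coord i := B.ext fun j => by
    rw [B.coord_apply, B.repr_self]
    by_cases hj : j = i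
    · subst hj
      rw [Finsupp.single_eq_same]
      exact hi
    · rw [Finsupp.single_eq_of_ne (Ne.symm hj)]
      exact hne j hj
  exact LinearMap.congr_fun this v

end Coordinates

theorem mainTheorem10 :
    (∀ (V : Type*) [AddCommGroup V] [Module ℝ V]
      (I J K : Type*) [Fintype I] [Fintype J] [Fintype K]
      (v : Module.Basis J ℝ V) (a : I → K → ℝ) (b : J → K → ℝ),
      (∃! x : I → V, ∀ k, ∑ i, a i k • x i + ∑ j, b j k • v j = 0) →
      (∀ (A : Finset K) (i : I), ∑ k ∈ A, a i k ∈ ({-1, 0, 1} : Set ℝ)) →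
      (∀ (A : Finset K) (j : J), ∑ k ∈ A, b j k ∈ ({-1, 0, 1} : Set ℝ)) →
      ∀ x : I → V, (∀ k, ∑ i, a i k • x i + ∑ j, b j k • v j = 0) →
        ∃ c : I → J → ℝ, (∀ i j, c i j ∈ ({-1, 0, 1} : Set ℝ)) ∧
          ∀ i, x i = ∑ j, c i j • v j) ∧
    (∀ (Γ : Subgroup PSL(2, ℝ)) (F : Set ℍ), IsFuchsian Γ → IsFundamentalPolygon Γ F →
      ∀ (ι : Type*) (B : Module.Basis ι ℝ (RealH1 (QuotSpace Γ))),
      (∀ i, ∃ σ ∈ sidePairings Γ F, ∃ (z : ℍ) (c : Path z (σ • z)), B i = sideClass σ z c) →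
      ∀ σ ∈ sidePairings Γ F, ∀ (z : ℍ) (c : Path z (σ • z)),
        (∀ i, B.repr (sideClass σ z c) i ∈ ({-1, 0, 1} : Set ℝ)) ∧
        ∀ ω ∈ dualBasis B, |capPairing (QuotSpace Γ) (sideClass σ z c) ω| ≤ 1) := by
  refine ⟨?_, ?_⟩
  · intro V _ _ I J K _ _ _ v a b huniq ha hb x hx
    refine ⟨fun i j => v.repr (x i) j,
      fun i j => coeff_mem_of_unique_solution v a b huniq ha hb x hx i j, fun i => ?_⟩
    exact (v.sum_repr (x i)).symm
  · intro Γ F _ h ι B hB σ hσ z c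
    refine ⟨h.repr_sideClass_mem B hB hσ z c, ?_⟩
    rintro ω ⟨i, hi, hne⟩
    rw [capPairing_eq_repr B ω i hi hne]
    rcases h.repr_sideClass_mem B hB hσ z c i with e | e | e
    · rw [e]; norm_num
    · rw [e]; norm_num
    · rw [Set.mem_singleton_iff.1 e]; norm_num
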